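/- There is an absolute constant $C>0$ such that for every finite simple connected graph $G$ with $n\ge 3$ vertices \[ t_{\mathrm{cov}}^{\mathrm{CRW}}(G)\;\le\; C\cdot t_{\mathrm{hit}}(G)\cdot \log(d_{\max})\cdot \log\!\left(\frac{d_{\mathrm{avg}}\cdot t_{\mathrm{rel}}\cdot \log n}{d_{\min}}\right). \] Here $\log$ is the natural logarithm, and $d_{\max}$, $d_{\min}$, $d_{\mathrm{avg}}$ are the maximum, minimum and average degree of $G$. The number $t_{\mathrm{hit}}(G)=\max_{x,y}\mathbb E_x[\min\{t\ge 0: Y_t=y\}]$ is the hitting time of the simple random walk $(Y_t)$ on $G$. The relaxation time is $t_{\mathrm{rel}}=1/(1-\lambda_2)$, where $\lambda_2$ is the second largest eigenvalue of the transition matrix of the lazy random walk, which stays put with probability $1/2$ and otherwise moves to a uniformly random neighbour. The choice random walk (CRW) is the process $(X_t)_{t\ge0}$ on the vertices in which, at each time $t$, two independent uniformly random neighbours of $X_t$ (possibly equal) are offered as an unordered pair, and a strategy selects one of them, possibly using additional randomness, as $X_{t+1}$; the choice may depend on all positions and offered pairs at times $0,\dots,t$. Finally $t_{\mathrm{cov}}^{\mathrm{CRW}}(G)=\max_{x}\min_{\sigma}\mathbb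 E_x^{\sigma}[\min\{t: \{X_0,\dots,X_t\}=V(G)\}]$, the minimum (infimum) being over all strategies $\sigma$. -/

import Mathlib

open MeasureTheory ProbabilityTheory
open scoped ENNReal

namespace ChoiceWalk

noncomputable section

/-- Unordered pairs carry the discrete σ-algebra. -/
instance instMeasurableSpaceSym2 (V : Type*) : MeasurableSpace (Sym2 V) := ⊤

instance instDiscreteMeasurableSpaceSym2 (V : Type*) : DiscreteMeasurableSpace (Sym2 V) :=
  ⟨fun _ => trivial⟩

/-- The law on `ℕ → S` of the discrete time process on the countable state space `S` whose initial
state has distribution `p₀`, and whose state at time `n + 1`, given the states `h` at the times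
`0, …, n`, has distribution `p n h`. -/
def processLaw {S : Type*} [MeasurableSpace S] [MeasurableSingletonClass S] [Countable S]
    (p₀ : PMF S) (p : (n : ℕ) → (Finset.Iic n → S) → PMF S) : Measure (ℕ → S) :=
  haveI : ∀ n : ℕ, IsMarkovKernel
      (Kernel.ofFunOfCountable fun h : Finset.Iic n → S => (p n h).toMeasure) :=
    fun n => ⟨fun h => inferInstanceAs (IsProbabilityMeasure (p n h).toMeasure)⟩
  Kernel.trajMeasure (X := fun _ => S) p₀.toMeasure
    (fun n => Kernel.ofFunOfCountable fun h : Finset.Iic n → S => (p n h).toMeasure)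

/-- The first time at which the trajectory `ω` is at `y` (`∞` if it never is). -/
def hitTime {V : Type*} (y : V) (ω : ℕ → V) : ℝ≥0∞ :=
  ⨅ (t : ℕ) (_ : ω t = y), (t : ℝ≥0∞)

/-- The first time by which the trajectory `ω` has visited every element of `V`
(`∞` if there is no such time). -/
def coverTime {V : Type*} (ω : ℕ → V) : ℝ≥0∞ :=
  ⨅ (t : ℕ) (_ : ∀ v : V, ∃ s ≤ t, ω s = v), (t : ℝ≥0∞)

section Graph

variable {V : Type*} [Fintype V] (G : SimpleGraph V) [DecidableRel G.Adj]

/-- A uniformly random neighbour of `v` (by convention `v` itself if `v` is isolated). -/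
def randomNeighbor (v : V) : PMF V :=
  if h : (G.neighborFinset v).Nonempty then PMF.uniformOfFinset (G.neighborFinset v) h
  else PMF.pure v

/-! ### The simple random walk -/

/-- The law of the simple random walk (SRW) on `G` started from `x`. -/
def srwLaw [MeasurableSpace V] [DiscreteMeasurableSpace V] (x : V) : Measure (ℕ → V) :=
  processLaw (PMF.pure x) fun n h => randomNeighbor G (h ⟨n, Finset.mem_Iic.2 le_rfl⟩)

/-- The hitting time of the SRW: the maximum over `x` and `y` of the expected time that the SRW
started from `x` takes to reach `y`. -/
def srwHittingTime [MeasurableSpace V] [DiscreteMeasurableSpace V] : ℝ≥0∞ :=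
  ⨆ (x : V) (y : V), ∫⁻ ω, hitTime y ω ∂(srwLaw G x)

/-! ### The choice random walk -/

/-- The pair of choices offered at `v`: two independent uniformly random neighbours of `v`,
as an unordered pair. -/
def randomOffer (v : V) : PMF (Sym2 V) :=
  (randomNeighbor G v).bind fun a => (randomNeighbor G v).map fun b => s(a, b)

/-- A strategy for the choice random walk (CRW). The history at time `n` records the position and
the offered pair at each of the times `0, …, n`, and the strategy chooses the next position,
possibly at random, from the pair offered at time `n`. -/
structure Strategy (V : Type*) where
  /-- The distribution of the next position, given the history. -/
  choose : (n : ℕ) → (Finset.Iic n → V × Sym2 V) → PMF V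
  choose_mem : ∀ (n : ℕ) (h : Finset.Iic n → V × Sym2 V), ∀ w ∈ (choose n h).support,
    w ∈ (h ⟨n, Finset.mem_Iic.2 le_rfl⟩).2

/-- The law of the CRW on `G` started from `x` and controlled by the strategy `σ`, as a process of
pairs consisting of the current position and the pair of choices offered there. -/
def crwLaw [MeasurableSpace V] [DiscreteMeasurableSpace V] (σ : Strategy V) (x : V) :
    Measure (ℕ → V × Sym2 V) :=
  processLaw ((randomOffer G x).map fun c => (x, c)) fun n h =>
    (σ.choose n h).bind fun w => (randomOffer G w).map fun c => (w, c)

/-- The optimal cover time of the CRW: the maximum over the starting vertex `x` of the least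
expected time, over all strategies, to visit every vertex. -/
def crwCoverTime [MeasurableSpace V] [DiscreteMeasurableSpace V] : ℝ≥0∞ :=
  ⨆ x : V, ⨅ σ : Strategy V, ∫⁻ ω, coverTime (fun t => (ω t).1) ∂(crwLaw G σ x)

/-! ### Parameters of the graph -/

/-- The average degree. -/
def avgDegree : ℝ := (∑ v : V, (G.degree v : ℝ)) / Fintype.card V

/-- The transition matrix of the lazy random walk with loop probability `1/2`. -/
def lazyMatrix [DecidableEq V] : Matrix V V ℝ :=
  Matrix.of fun x y =>
    (if x = y then 1 / 2 else 0) + (if G.Adj x y then 1 / (2 * (G.degree x : ℝ)) else 0)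

/-- The second largest eigenvalue of the transition matrix of the lazy random walk. The eigenvalues
(all of which are real) are listed with multiplicity in non-increasing order; on a single vertex,
where there is no second eigenvalue, the value is `0`. -/
def lambdaTwo [DecidableEq V] : ℝ :=
  ((lazyMatrix G).charpoly.roots.sort (· ≥ ·)).getD 1 0

/-- The relaxation time of the lazy random walk. -/
def relaxationTime [DecidableEq V] : ℝ := 1 / (1 - lambdaTwo G)

end Graph

end

end ChoiceWalk

/-! The walk runs in two phases. While the choice is ignored it is a simple random walk, and by
Markov's inequality a given vertex survives a period of about 2·t_hit steps with probability at most
1/2. After k periods at most n·2^(-k) vertices are left on average. The choice is then used to hunt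
down the rest.

When r vertices U are left, T ≈ 3·t_rel·log n lazy steps end in U with probability at least half the
stationary measure of U, hence at least r/ρ with ρ = 2·n·d_avg/d_min. The non-lazy walk is at least
as likely to have visited U (`half_le_hitProb`). Taking the better of two offers turns a hitting
probability p into at least p^(1-ε), where ε = log(3/2)/log d_max
(`hitProb_rpow_le_boostedHitProb`). The next new vertex therefore costs at most T·(ρ/r)^(1-ε), and R
leftover vertices cost at most T·ρ^(1-ε)·R^ε/ε.

Let S be the argument of the last logarithm. With 2^(kε) ≥ S the second phase costs O(n/ε) =
O(t_hit/ε) and the first O(t_hit·(1 + log S/ε)). Since 1/ε is of order log d_max and S ≥ log 3, this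
is the claim.

Costs are estimated through the truncated Bellman recursion `optimalCost`. Its limit is a potential
that a greedy strategy follows (`exists_strategy_lintegral_coverTime_le`). -/

namespace ChoiceWalk

/-! ### One-step integration against path measures -/

section Trajectory

variable {S : Type*} [MeasurableSpace S] [MeasurableSingletonClass S] [Countable S]

theorem lintegral_toMeasure_eq_tsum (p : PMF S) (f : S → ℝ≥0∞) :
    ∫⁻ s, f s ∂p.toMeasure = ∑' s, p s * f s := by
  rw [lintegral_countable']
  refine tsum_congr fun s => ?_
  rw [p.toMeasure_apply_singleton s (measurableSet_singleton s), mul_comm]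

theorem lintegral_processLaw_zero (p₀ : PMF S) (p : (n : ℕ) → (Finset.Iic n → S) → PMF S)
    (f : S → ℝ≥0∞) : ∫⁻ ω, f (ω 0) ∂(processLaw p₀ p) = ∑' s, p₀ s * f s := by
  have hf' : Measurable fun h : Finset.Iic 0 → S => f (h ⟨0, by simp⟩) := measurable_of_countable _
  have : ∀ n : ℕ, IsMarkovKernel
      (Kernel.ofFunOfCountable fun h : Finset.Iic n → S => (p n h).toMeasure) :=
    fun n => ⟨fun h => inferInstanceAs (IsProbabilityMeasure (p n h).toMeasure)⟩
  have h1 : ∫⁻ ω, f (ω 0) ∂(processLaw p₀ p) =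
      ∫⁻ h, f (h ⟨0, by simp⟩) ∂((processLaw p₀ p).map (Preorder.frestrictLe 0)) := by
    exact (lintegral_map hf' (Preorder.measurable_frestrictLe (X := fun _ => S) 0)).symm
  rw [h1, processLaw, Kernel.trajMeasure, Measure.map_comp _ _ (by fun_prop),
    Kernel.traj_map_frestrictLe, Kernel.partialTraj_self, Measure.id_comp]
  exact (lintegral_map hf' (by fun_prop)).trans
    (lintegral_toMeasure_eq_tsum p₀ f)

/-- Together with `lintegral_processLaw_zero` this reduces the later expectations over trajectories
to finite recursions. -/
theorem lintegral_processLaw_succ (p₀ : PMF S) (p : (n : ℕ) → (Finset.Iic n → S) → PMF S)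
    (n : ℕ) (g : (Finset.Iic n → S) → S → ℝ≥0∞) :
    ∫⁻ ω, g (Preorder.frestrictLe n ω) (ω (n + 1)) ∂(processLaw p₀ p) =
      ∫⁻ ω, ∑' s, p n (Preorder.frestrictLe n ω) s * g (Preorder.frestrictLe n ω) s
        ∂(processLaw p₀ p) := by
  have : ∀ n : ℕ, IsMarkovKernel
      (Kernel.ofFunOfCountable fun h : Finset.Iic n → S => (p n h).toMeasure) :=
    fun n => ⟨fun h => inferInstanceAs (IsProbabilityMeasure (p n h).toMeasure)⟩
  have hg : Measurable (fun q : (Finset.Iic n → S) × S => g q.1 q.2) := measurable_of_countable _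
  have key := Kernel.map_frestrictLe_trajMeasure_compProd_eq_map_trajMeasure (X := fun _ => S)
    (μ₀ := p₀.toMeasure)
    (κ := fun n => Kernel.ofFunOfCountable fun h : Finset.Iic n → S => (p n h).toMeasure) (a := n)
  have h2 := congrArg (fun μ : Measure ((Finset.Iic n → S) × S) =>
    ∫⁻ q, g q.1 q.2 ∂μ) key
  rw [lintegral_map hg (by fun_prop)] at h2
  refine h2.symm.trans ?_
  have : IsProbabilityMeasure (Kernel.trajMeasure (X := fun _ => S) p₀.toMeasure
    (fun n => Kernel.ofFunOfCountable fun h : Finset.Iic n → S => (p n h).toMeasure)) := inferInstance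
  rw [Measure.lintegral_compProd hg, lintegral_map (measurable_of_countable _) (by fun_prop)]
  refine lintegral_congr fun ω => ?_
  exact lintegral_toMeasure_eq_tsum _ _

theorem measurable_comp_frestrictLe {β : Type*} [MeasurableSpace β] (n : ℕ)
    (f : (Finset.Iic n → S) → β) :
    Measurable fun ω : ℕ → S => f (Preorder.frestrictLe n ω) :=
  (measurable_of_countable f).comp (Preorder.measurable_frestrictLe (X := fun _ => S) n)

end Trajectory

/-- A time counts the instants before it, so expected times become sums of survival probabilities.
Hitting times need only this direction, cover times only the opposite one. -/
theorem sum_indicator_le_hitTime {V : Type*} (y : V) (ω : ℕ → V) (m : ℕ) :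
    ∑ t ∈ Finset.range m, {t : ℕ | ∀ s ≤ t, ω s ≠ y}.indicator (1 : ℕ → ℝ≥0∞) t ≤ hitTime y ω := by
  classical
  refine le_iInf₂ fun t₀ ht₀ => ?_
  calc ∑ t ∈ Finset.range m, {t : ℕ | ∀ s ≤ t, ω s ≠ y}.indicator (1 : ℕ → ℝ≥0∞) t
      ≤ ∑ t ∈ Finset.range m, if t ∈ Finset.range t₀ then (1 : ℝ≥0∞) else 0 := by
        refine Finset.sum_le_sum fun t _ => ?_
        by_cases h : t < t₀
        · rw [if_pos (Finset.mem_range.2 h)]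
          exact Set.indicator_le_self' (by simp) t
        · rw [if_neg (by simpa using h), Set.indicator_of_notMem]
          exact fun h' => h' t₀ (not_lt.1 h) ht₀
    _ = ((Finset.range m ∩ Finset.range t₀).card : ℝ≥0∞) := by
        rw [Finset.sum_ite_mem]; simp
    _ ≤ t₀ := by
        exact_mod_cast (Finset.card_le_card Finset.inter_subset_right).trans
          (Finset.card_range t₀).le

theorem coverTime_le_tsum {V : Type*} (ω : ℕ → V) :
    coverTime ω ≤ ∑' t, {t : ℕ | ¬ ∀ v : V, ∃ s ≤ t, ω s = v}.indicator (1 : ℕ → ℝ≥0∞) t := by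
  classical
  by_cases h : ∃ t, ∀ v : V, ∃ s ≤ t, ω s = v
  · refine (iInf₂_le (Nat.find h) (Nat.find_spec h)).trans ?_
    refine le_trans ?_ (ENNReal.sum_le_tsum (Finset.range (Nat.find h)))
    rw [Finset.sum_congr rfl (g := fun _ => 1)]
    · simp
    · intro t ht
      rw [Set.indicator_of_mem (Nat.find_min h (Finset.mem_range.1 ht))]
      rfl
  · push Not at h
    have : {t : ℕ | ¬ ∀ v : V, ∃ s ≤ t, ω s = v}.indicator (1 : ℕ → ℝ≥0∞) = 1 := by
      ext t
      rw [Set.indicator_of_mem]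
      intro h'
      obtain ⟨v, hv⟩ := h t
      obtain ⟨s, hs, hs'⟩ := h' v
      exact hv s hs hs'
    rw [this]
    simp

/-- The smaller of the values of `f` at the two elements of an unordered pair. -/
def offerMin {V α : Type*} [LinearOrder α] (f : V → α) : Sym2 V → α :=
  Sym2.lift ⟨fun a b => min (f a) (f b), fun _ _ => min_comm _ _⟩

theorem exists_mem_eq_offerMin {V α : Type*} [LinearOrder α] (f : V → α) (c : Sym2 V) :
    ∃ w ∈ c, f w = offerMin f c := by
  induction c using Sym2.ind with
  | _ a b =>
    rcases min_choice (f a) (f b) with h | h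
    · exact ⟨a, by simp, h.symm⟩
    · exact ⟨b, by simp, h.symm⟩

/-! ### Path expectations as recursions, and the greedy strategy -/

section Graph

variable {V : Type*} [Fintype V] (G : SimpleGraph V) [DecidableRel G.Adj]

/-- The average of `f` over the neighbours of `x`. -/
noncomputable def nbrAvg (x : V) (f : V → ℝ) : ℝ := (∑ y ∈ G.neighborFinset x, f y) / G.degree x

variable {G}

theorem tsum_randomNeighbor_mul {x : V} (hx : 0 < G.degree x) {f : V → ℝ} (hf : ∀ y, 0 ≤ f y) :
    ∑' y, randomNeighbor G x y * ENNReal.ofReal (f y) = ENNReal.ofReal (nbrAvg G x f) := by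
  classical
  have hne : (G.neighborFinset x).Nonempty := by
    rw [← Finset.card_pos, G.card_neighborFinset_eq_degree]; exact hx
  have hd : (0 : ℝ) < G.degree x := by exact_mod_cast hx
  rw [tsum_fintype, nbrAvg, ENNReal.ofReal_div_of_pos hd, ENNReal.ofReal_sum_of_nonneg
    (fun y _ => hf y), ENNReal.ofReal_natCast, div_eq_mul_inv, Finset.sum_mul]
  simp only [randomNeighbor, dif_pos hne, PMF.uniformOfFinset_apply, ite_mul, zero_mul]
  rw [Finset.sum_ite_mem, Finset.univ_inter, G.card_neighborFinset_eq_degree]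
  exact Finset.sum_congr rfl fun y _ => mul_comm _ _

theorem tsum_map_mul {α β : Type*} (p : PMF α) (φ : α → β) (f : β → ℝ≥0∞) :
    ∑' b, p.map φ b * f b = ∑' a, p a * f (φ a) := by
  classical
  simp only [PMF.map_apply, ← ENNReal.tsum_mul_right]
  rw [ENNReal.tsum_comm]
  refine tsum_congr fun a => ?_
  rw [tsum_eq_single (φ a)]
  · simp
  · intro b hb
    simp [hb]

theorem tsum_bind_mul {α β : Type*} (p : PMF α) (q : α → PMF β) (f : β → ℝ≥0∞) :
    ∑' b, p.bind q b * f b = ∑' a, p a * ∑' b, q a b * f b := by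
  simp only [PMF.bind_apply, ← ENNReal.tsum_mul_right, ← ENNReal.tsum_mul_left]
  rw [ENNReal.tsum_comm]
  simp only [mul_assoc]

theorem tsum_pure_mul {α : Type*} (a : α) (f : α → ℝ≥0∞) :
    ∑' b, PMF.pure a b * f b = f a := by
  rw [tsum_eq_single a]
  · simp
  · intro b hb
    simp [hb]

theorem nbrAvg_nonneg {x : V} {f : V → ℝ} (hf : ∀ y, 0 ≤ f y) : 0 ≤ nbrAvg G x f :=
  div_nonneg (Finset.sum_nonneg fun y _ => hf y) (Nat.cast_nonneg _)

theorem tsum_randomOffer_mul {x : V} (hx : 0 < G.degree x) {f : V → ℝ} (hf : ∀ y, 0 ≤ f y) :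
    ∑' c, randomOffer G x c * offerMin (fun w => ENNReal.ofReal (f w)) c =
      ENNReal.ofReal (nbrAvg G x fun a => nbrAvg G x fun b => min (f a) (f b)) := by
  rw [randomOffer, tsum_bind_mul, ← tsum_randomNeighbor_mul hx
    (fun a => nbrAvg_nonneg fun b => le_min (hf a) (hf b))]
  refine tsum_congr fun a => ?_
  rw [tsum_map_mul, ← tsum_randomNeighbor_mul hx (fun b => le_min (hf a) (hf b))]
  congr 1
  refine tsum_congr fun b => ?_
  simp [offerMin, ENNReal.ofReal_min]

variable (G) in
/-- The probability that the simple random walk started from `x` does not visit `y` at any of the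
times `0, …, t`. -/
noncomputable def avoidProb [DecidableEq V] (y : V) : ℕ → V → ℝ
  | 0, x => if x = y then 0 else 1
  | t + 1, x => if x = y then 0 else nbrAvg G x (avoidProb y t)

theorem avoidProb_nonneg [DecidableEq V] (y : V) (t : ℕ) (x : V) : 0 ≤ avoidProb G y t x := by
  induction t generalizing x with
  | zero => rw [avoidProb]; split_ifs <;> norm_num
  | succ t ih =>
    rw [avoidProb]
    split_ifs
    · exact le_rfl
    · exact nbrAvg_nonneg ih

@[simp] theorem avoidProb_self [DecidableEq V] (y : V) (t : ℕ) : avoidProb G y t y = 0 := by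
  cases t <;> simp [avoidProb]

/-- The vertices not visited by a history of the choice random walk. -/
def unvisited [DecidableEq V] {n : ℕ} (h : Finset.Iic n → V × Sym2 V) : Finset V :=
  Finset.univ.filter fun v => ∀ i, (h i).1 ≠ v

theorem unvisited_frestrictLe_succ [DecidableEq V] (n : ℕ) (ω : ℕ → V × Sym2 V) :
    unvisited (Preorder.frestrictLe (π := fun _ => V × Sym2 V) (n + 1) ω) =
      (unvisited (Preorder.frestrictLe (π := fun _ => V × Sym2 V) n ω)).erase (ω (n + 1)).1 := by
  ext v
  simp only [unvisited, Finset.mem_filter, Finset.mem_univ, true_and, Subtype.forall,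
    Finset.mem_Iic, Preorder.frestrictLe_apply, Finset.mem_erase]
  constructor
  · exact fun h => ⟨(h (n + 1) le_rfl).symm, fun i hi => h i (hi.trans (Nat.le_succ n))⟩
  · rintro ⟨h1, h2⟩ i hi
    rcases Nat.lt_or_eq_of_le hi with h' | rfl
    · exact h2 i (Nat.lt_succ_iff.1 h')
    · exact h1.symm

variable [MeasurableSpace V] [DiscreteMeasurableSpace V]

/-- Interpolates between the recursion (j = 0) and the path event (k = 0), moving one step at a time
from the path into the recursion. -/
theorem lintegral_avoid_eq [DecidableEq V] (hG : ∀ v, 0 < G.degree v) (x y : V) (j k : ℕ) :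
    ∫⁻ ω, {h : Finset.Iic j → V | ∀ i, h i ≠ y}.indicator 1 (Preorder.frestrictLe j ω) *
        ENNReal.ofReal (avoidProb G y k (ω j)) ∂(srwLaw G x) =
      ENNReal.ofReal (avoidProb G y (j + k) x) := by
  induction j generalizing k with
  | zero =>
    rw [zero_add]
    have h1 := lintegral_processLaw_zero (PMF.pure x)
      (fun n (h : Finset.Iic n → V) => randomNeighbor G (h ⟨n, Finset.mem_Iic.2 le_rfl⟩))
      (fun s => ENNReal.ofReal (avoidProb G y k s))
    rw [tsum_pure_mul] at h1
    rw [← h1, srwLaw]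
    refine lintegral_congr fun ω => ?_
    by_cases h0 : ω 0 = y
    · simp [h0]
    · rw [Set.indicator_of_mem, Pi.one_apply, one_mul]
      rintro ⟨i, hi⟩
      obtain rfl : i = 0 := by simpa using hi
      exact h0
  | succ j ih =>
    rw [show j + 1 + k = j + (k + 1) by ring, ← ih (k + 1), srwLaw]
    have h1 := lintegral_processLaw_succ (PMF.pure x)
      (fun n (h : Finset.Iic n → V) => randomNeighbor G (h ⟨n, Finset.mem_Iic.2 le_rfl⟩)) j
      (fun h s => {h : Finset.Iic j → V | ∀ i, h i ≠ y}.indicator 1 h *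
        ENNReal.ofReal (avoidProb G y k s))
    refine Eq.trans (lintegral_congr fun ω => ?_) (h1.trans (lintegral_congr fun ω => ?_))
    · by_cases hy : ω (j + 1) = y
      · simp [hy]
      · congr 1
        have : (Preorder.frestrictLe (j + 1) ω ∈ {h : Finset.Iic (j + 1) → V | ∀ i, h i ≠ y}) ↔
            (Preorder.frestrictLe j ω ∈ {h : Finset.Iic j → V | ∀ i, h i ≠ y}) := by
          simp only [Set.mem_ofPred_eq, Subtype.forall, Finset.mem_Iic, Preorder.frestrictLe_apply]
          constructor
          · exact fun h i hi => h i (hi.trans (Nat.le_succ j))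
          · intro h i hi
            rcases Nat.lt_or_eq_of_le hi with h' | rfl
            · exact h i (Nat.lt_succ_iff.1 h')
            · exact hy
        by_cases hm : Preorder.frestrictLe j ω ∈ {h : Finset.Iic j → V | ∀ i, h i ≠ y}
        · rw [Set.indicator_of_mem hm, Set.indicator_of_mem (this.2 hm)]; rfl
        · rw [Set.indicator_of_notMem hm, Set.indicator_of_notMem (fun h => hm (this.1 h))]
    · simp only [mul_left_comm _ (Set.indicator _ _ _), ENNReal.tsum_mul_left]
      rw [tsum_randomNeighbor_mul (hG _) (avoidProb_nonneg y k)]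
      by_cases hy : ω j = y
      · rw [Set.indicator_of_notMem, zero_mul, zero_mul]
        exact fun h => h ⟨j, Finset.mem_Iic.2 le_rfl⟩ hy
      · congr 2
        rw [avoidProb, if_neg hy]
        rfl

theorem sum_avoidProb_le_srwHittingTime [DecidableEq V] (hG : ∀ v, 0 < G.degree v)
    (x y : V) (m : ℕ) :
    ENNReal.ofReal (∑ t ∈ Finset.range m, avoidProb G y t x) ≤ srwHittingTime G := by
  refine le_trans ?_ (le_iSup₂ (f := fun x y => ∫⁻ ω, hitTime y ω ∂(srwLaw G x)) x y)
  refine le_trans ?_ (lintegral_mono fun ω => sum_indicator_le_hitTime y ω m)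
  have hrw : ∀ t (ω : ℕ → V), {t : ℕ | ∀ s ≤ t, ω s ≠ y}.indicator (1 : ℕ → ℝ≥0∞) t =
      {h : Finset.Iic t → V | ∀ i, h i ≠ y}.indicator (fun _ => (1 : ℝ≥0∞))
        (Preorder.frestrictLe t ω) := by
    intro t ω
    classical
    rw [Set.indicator_apply, Set.indicator_apply]
    simp
  simp only [hrw]
  rw [lintegral_finsetSum _ fun t _ => measurable_comp_frestrictLe t _,
    ENNReal.ofReal_sum_of_nonneg fun t _ => avoidProb_nonneg y t x]
  refine Finset.sum_le_sum fun t _ => ?_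
  rw [← add_zero t, ← lintegral_avoid_eq hG x y t 0]
  refine lintegral_mono fun ω => ?_
  refine (mul_le_of_le_one_right (zero_le) ?_).trans_eq rfl
  rw [avoidProb]
  split_ifs <;> simp

/-- The strategy that moves to the offered vertex where the potential `Φ`, evaluated at the vertex
and the set of vertices that are then still unvisited, is smallest. -/
noncomputable def greedyStrategy [DecidableEq V] (Φ : V → Finset V → ℝ≥0∞) : Strategy V where
  choose n h := PMF.pure (exists_mem_eq_offerMin (fun w => Φ w ((unvisited h).erase w))
    (h ⟨n, Finset.mem_Iic.2 le_rfl⟩).2).choose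
  choose_mem n h w hw := by
    rw [PMF.support_pure, Set.mem_singleton_iff] at hw
    subst hw
    exact (exists_mem_eq_offerMin (fun w => Φ w ((unvisited h).erase w))
      (h ⟨n, Finset.mem_Iic.2 le_rfl⟩).2).choose_spec.1

/-- A potential that decreases on average by at least one in each step before the graph is covered,
if the better of the two offers is taken, bounds the cover time. -/
theorem exists_strategy_lintegral_coverTime_le [DecidableEq V] (Φ : V → Finset V → ℝ≥0∞)
    (hΦ : ∀ x U, (if U = ∅ then 0 else 1) +
      ∑' c, randomOffer G x c * offerMin (fun w => Φ w (U.erase w)) c ≤ Φ x U) (x : V) :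
    ∃ σ : Strategy V, ∫⁻ ω, coverTime (fun t => (ω t).1) ∂(crwLaw G σ x) ≤
      Φ x (Finset.univ.erase x) := by
  set σ := greedyStrategy Φ with hσ
  -- The potential just after an offer is seen and before the move; the telescoping takes place at
  -- these moments.
  set ψ : Sym2 V → Finset V → ℝ≥0∞ := fun c U =>
    (if U = ∅ then 0 else 1) + offerMin (fun w => Φ w (U.erase w)) c with hψ
  have hψΦ : ∀ w U, ∑' c, randomOffer G w c * ψ c U ≤ Φ w U := by
    intro w U
    refine le_trans (le_of_eq ?_) (hΦ w U)
    simp only [hψ, mul_add, ENNReal.tsum_add, ENNReal.tsum_mul_right, PMF.tsum_coe, one_mul]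
  set R : ℕ → ℝ≥0∞ := fun n => ∫⁻ ω, (if unvisited (Preorder.frestrictLe
    (π := fun _ => V × Sym2 V) n ω) = ∅ then 0 else 1) ∂(crwLaw G σ x) with hR
  set F : ℕ → ℝ≥0∞ := fun n => ∫⁻ ω, ψ (ω n).2 (unvisited (Preorder.frestrictLe
    (π := fun _ => V × Sym2 V) n ω)) ∂(crwLaw G σ x) with hF
  have hstep : ∀ n, R n + F (n + 1) ≤ F n := by
    intro n
    have h1 : F (n + 1) ≤ ∫⁻ ω, offerMin (fun w => Φ w ((unvisited (Preorder.frestrictLe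
        (π := fun _ => V × Sym2 V) n ω)).erase w)) (ω n).2 ∂(crwLaw G σ x) := by
      simp only [hF, unvisited_frestrictLe_succ]
      have h2 := lintegral_processLaw_succ ((randomOffer G x).map fun c => (x, c))
        (fun n h => (σ.choose n h).bind fun w => (randomOffer G w).map fun c => (w, c)) n
        (fun h s => ψ s.2 ((unvisited h).erase s.1))
      rw [crwLaw, h2]
      refine lintegral_mono fun ω => ?_
      simp only [hσ, greedyStrategy, PMF.pure_bind, tsum_map_mul]
      refine (hψΦ _ _).trans (le_of_eq ?_)
      exact (exists_mem_eq_offerMin (fun w => Φ w ((unvisited (Preorder.frestrictLe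
        (π := fun _ => V × Sym2 V) n ω)).erase w)) (ω n).2).choose_spec.2
    refine (add_le_add_right h1 _).trans ?_
    rw [hR]
    simp only
    rw [← lintegral_add_left (measurable_comp_frestrictLe n
      (fun h : Finset.Iic n → V × Sym2 V => if unvisited h = ∅ then (0 : ℝ≥0∞) else 1))]
  have hsum : ∀ m, ∑ n ∈ Finset.range m, R n + F m ≤ F 0 := by
    intro m
    induction m with
    | zero => simp
    | succ m ih =>
      rw [Finset.sum_range_succ, add_assoc]
      exact (add_le_add_right (hstep m) _).trans ih
  have hF0 : F 0 ≤ Φ x (Finset.univ.erase x) := by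
    have h0 := lintegral_processLaw_zero ((randomOffer G x).map fun c => (x, c))
      (fun n h => (σ.choose n h).bind fun w => (randomOffer G w).map fun c => (w, c))
      (fun s => ψ s.2 (Finset.univ.erase s.1))
    rw [tsum_map_mul] at h0
    refine le_trans (le_of_eq ?_) (hψΦ x (Finset.univ.erase x))
    rw [← h0]
    refine lintegral_congr fun ω => ?_
    congr 1
    ext v
    simp only [unvisited, Finset.mem_filter, Finset.mem_univ, true_and, Subtype.forall,
      Finset.mem_Iic, Preorder.frestrictLe_apply, Finset.mem_erase, nonpos_iff_eq_zero, forall_eq,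
      and_true]
    exact ne_comm
  refine ⟨σ, ?_⟩
  calc ∫⁻ ω, coverTime (fun t => (ω t).1) ∂(crwLaw G σ x)
      ≤ ∫⁻ ω, ∑' n, (if unvisited (Preorder.frestrictLe (π := fun _ => V × Sym2 V) n ω) = ∅
          then 0 else 1) ∂(crwLaw G σ x) := by
        refine lintegral_mono fun ω => (coverTime_le_tsum _).trans ?_
        refine ENNReal.tsum_le_tsum fun n => ?_
        split_ifs with h
        · rw [Set.indicator_of_notMem]
          simp only [Set.mem_ofPred_eq, not_not]
          intro v
          by_contra hv
          push Not at hv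
          have : v ∈ unvisited (Preorder.frestrictLe (π := fun _ => V × Sym2 V) n ω) := by
            simpa [unvisited] using hv
          simp [h] at this
        · exact Set.indicator_le_self' (by simp) n
    _ = ∑' n, R n := lintegral_tsum fun n => (measurable_comp_frestrictLe n
          (fun h : Finset.Iic n → V × Sym2 V =>
            if unvisited h = ∅ then (0 : ℝ≥0∞) else 1)).aemeasurable
    _ ≤ F 0 := ENNReal.tsum_le_of_sum_range_le fun m => le_self_add.trans (hsum m)
    _ ≤ _ := hF0

end Graph

/-! ### Calculus of neighbour averages -/

section Averages

variable {V : Type*} [Fintype V] {G : SimpleGraph V} [DecidableRel G.Adj]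

theorem nbrAvg_mono {x : V} {f g : V → ℝ} (h : ∀ y, f y ≤ g y) : nbrAvg G x f ≤ nbrAvg G x g :=
  div_le_div_of_nonneg_right (Finset.sum_le_sum fun y _ => h y) (Nat.cast_nonneg _)

theorem nbrAvg_const {x : V} (hx : 0 < G.degree x) (c : ℝ) : nbrAvg G x (fun _ => c) = c := by
  have : (G.degree x : ℝ) ≠ 0 := by exact_mod_cast hx.ne'
  rw [nbrAvg, Finset.sum_const, G.card_neighborFinset_eq_degree, nsmul_eq_mul]
  field_simp

theorem nbrAvg_add {x : V} (f g : V → ℝ) :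
    nbrAvg G x (fun y => f y + g y) = nbrAvg G x f + nbrAvg G x g := by
  rw [nbrAvg, Finset.sum_add_distrib, add_div, nbrAvg, nbrAvg]

theorem nbrAvg_const_mul {x : V} (c : ℝ) (f : V → ℝ) :
    nbrAvg G x (fun y => c * f y) = c * nbrAvg G x f := by
  rw [nbrAvg, ← Finset.mul_sum, mul_div_assoc, nbrAvg]

theorem nbrAvg_sum {ι : Type*} {x : V} (s : Finset ι) (f : ι → V → ℝ) :
    nbrAvg G x (fun y => ∑ i ∈ s, f i y) = ∑ i ∈ s, nbrAvg G x (f i) := by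
  simp only [nbrAvg]
  rw [Finset.sum_comm, Finset.sum_div]

theorem nbrAvg_le {x : V} (hx : 0 < G.degree x) {f : V → ℝ} {c : ℝ} (h : ∀ y, f y ≤ c) :
    nbrAvg G x f ≤ c :=
  (nbrAvg_mono h).trans_eq (nbrAvg_const hx c)

end Averages

/-! ### Boosting hitting probabilities by choice -/

section Boosting

/-- A weighted norm of exponent `1 / γ` is dominated by the average of pairwise maxima as soon as
this holds for indicator functions. -/
theorem rpow_sum_le_mul_sum_max {ι : Type*} (s : Finset ι) {γ K : ℝ} (hγ : 0 < γ) (hγ1 : γ ≤ 1)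
    (hK : ∀ k : ℕ, k ≤ s.card →
      (k : ℝ) ^ γ ≤ K * ((s.card : ℝ) ^ 2 - ((s.card : ℝ) - k) ^ 2))
    (hK0 : 0 ≤ K) (v : ι → ℝ) (hv : ∀ i, 0 ≤ v i) :
    (∑ i ∈ s, v i ^ (1 / γ)) ^ γ ≤ K * ∑ i ∈ s, ∑ j ∈ s, max (v i) (v j) := by
  classical
  induction hn : (s.filter fun i => 0 < v i).card using Nat.strong_induction_on generalizing v with
  | _ n ih =>
  set A := s.filter fun i => 0 < v i with hA
  rcases A.eq_empty_or_nonempty with hA0 | hA0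
  · have h0 : ∀ i ∈ s, v i = 0 := by
      intro i hi
      by_contra h
      have : i ∈ A := Finset.mem_filter.2 ⟨hi, lt_of_le_of_ne (hv i) (Ne.symm h)⟩
      simp [hA0] at this
    rw [Finset.sum_congr rfl (g := fun _ => (0 : ℝ))]
    · rw [Finset.sum_const_zero, Real.zero_rpow hγ.ne']
      exact mul_nonneg hK0 (Finset.sum_nonneg fun i _ => Finset.sum_nonneg fun j _ =>
        le_max_of_le_left (hv i))
    · intro i hi
      rw [h0 i hi, Real.zero_rpow (by positivity)]
  -- Layer-cake step: peel the least positive value off the support `A`. Pairwise maxima are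
  -- additive under this splitting, while the norm of exponent 1/γ ≥ 1 is subadditive by Minkowski,
  -- which is the direction needed.
  · obtain ⟨i₀, hi₀, hmin⟩ := A.exists_min_image v hA0
    set m := v i₀ with hm
    have hm0 : 0 < m := (Finset.mem_filter.1 hi₀).2
    set w : ι → ℝ := fun i => if i ∈ A then v i - m else 0 with hw
    set e : ι → ℝ := fun i => if i ∈ A then 1 else 0 with he
    have hw0 : ∀ i, 0 ≤ w i := by
      intro i
      by_cases hi : i ∈ A
      · simp only [hw, if_pos hi]; linarith [hmin i hi]
      · simp [hw, if_neg hi]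
    have hdec : ∀ i ∈ s, v i = m * e i + w i := by
      intro i hi
      by_cases hiA : i ∈ A
      · simp [hw, he, if_pos hiA]
      · have : ¬ 0 < v i := fun h => hiA (Finset.mem_filter.2 ⟨hi, h⟩)
        simp only [hw, he, if_neg hiA]
        linarith [hv i, not_lt.1 this]
    have hcard : (s.filter fun i => 0 < w i).card < n := by
      rw [← hn]
      refine Finset.card_lt_card ⟨?_, ?_⟩
      · intro i hi
        by_contra hiA
        simp [hw, if_neg hiA] at hi
      · intro h
        have := (Finset.mem_filter.1 (h hi₀)).2
        simp [hw, if_pos hi₀, ← hm] at this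
    have hrec := ih _ hcard w hw0 rfl
    have hmax : ∀ i ∈ s, ∀ j ∈ s, max (v i) (v j) =
        m * (1 - (1 - e i) * (1 - e j)) + max (w i) (w j) := by
      intro i hi j hj
      rw [hdec i hi, hdec j hj]
      by_cases hiA : i ∈ A <;> by_cases hjA : j ∈ A
      · simp only [he, if_pos hiA, if_pos hjA]
        rw [max_add_add_left]; ring
      · simp only [he, hw, if_pos hiA, if_neg hjA]
        have := hmin i hiA
        rw [max_eq_left (by linarith), max_eq_left (by linarith)]; ring
      · simp only [he, hw, if_neg hiA, if_pos hjA]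
        have := hmin j hjA
        rw [max_eq_right (by linarith), max_eq_right (by linarith)]; ring
      · simp only [he, hw, if_neg hiA, if_neg hjA]; ring_nf
    have hAs : A ⊆ s := Finset.filter_subset _ _
    have hesum : ∑ i ∈ s, e i = A.card := by
      simp only [he]
      rw [Finset.sum_ite_mem, Finset.inter_eq_right.2 hAs]; simp
    have hsum : ∑ i ∈ s, ∑ j ∈ s, max (v i) (v j) =
        m * ((s.card : ℝ) ^ 2 - ((s.card : ℝ) - A.card) ^ 2) +
          ∑ i ∈ s, ∑ j ∈ s, max (w i) (w j) := by
      rw [Finset.sum_congr rfl fun i hi => Finset.sum_congr rfl fun j hj => hmax i hi j hj]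
      simp only [Finset.sum_add_distrib, ← Finset.mul_sum, Finset.sum_sub_distrib,
        Finset.sum_const, nsmul_eq_mul, ← Finset.sum_mul, hesum]
      ring
    have hMink := Real.Lp_add_le_of_nonneg s (p := 1 / γ) (f := fun i => m * e i) (g := w)
      (by rw [le_div_iff₀ hγ]; linarith)
      (fun i _ => mul_nonneg hm0.le (by simp only [he]; split_ifs <;> norm_num))
      (fun i _ => hw0 i)
    rw [one_div_one_div] at hMink
    have hind : (∑ i ∈ s, (m * e i) ^ (1 / γ)) ^ γ = m * (A.card : ℝ) ^ γ := by
      have : ∀ i ∈ s, (m * e i) ^ (1 / γ) = if i ∈ A then m ^ (1 / γ) else 0 := by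
        intro i _
        by_cases hiA : i ∈ A
        · simp [he, if_pos hiA]
        · simp only [he, if_neg hiA, mul_zero]
          exact Real.zero_rpow (by positivity)
      rw [Finset.sum_congr rfl this, Finset.sum_ite_mem, Finset.inter_eq_right.2 hAs,
        Finset.sum_const, nsmul_eq_mul, Real.mul_rpow (by positivity) (by positivity),
        ← Real.rpow_mul hm0.le, one_div_mul_cancel hγ.ne', Real.rpow_one, mul_comm]
    rw [hind] at hMink
    rw [Finset.sum_congr rfl fun i hi => by rw [hdec i hi], hsum, mul_add]
    refine hMink.trans (add_le_add ?_ hrec)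
    have := mul_le_mul_of_nonneg_left (hK A.card (Finset.card_le_card hAs)) hm0.le
    linarith

/-- Write r = D^(-θ) with 0 ≤ θ ≤ 1. Bernoulli's inequality bounds (3/2)^θ by 1 + θ/2 and r by 1 -
θ(1 - 1/D) ≤ 1 - θ/2, so (3/2)^θ ≤ 2 - r. The case r = 1/D = 1/2 shows that 3/2 is the largest
constant valid for all D ≥ 2. -/
theorem rpow_one_sub_le {D r : ℝ} (hD : 2 ≤ D) (hr : 1 / D ≤ r) (hr1 : r ≤ 1) :
    r ^ (1 - Real.log (3 / 2) / Real.log D) ≤ r * (2 - r) := by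
  have hr0 : 0 < r := lt_of_lt_of_le (by positivity) hr
  have hlD : 0 < Real.log D := Real.log_pos (by linarith)
  set θ := -Real.log r / Real.log D with hθ
  have hθ0 : 0 ≤ θ := div_nonneg (by linarith [Real.log_nonpos hr0.le hr1]) hlD.le
  have hθ1 : θ ≤ 1 := by
    rw [hθ, div_le_one hlD]
    have := Real.log_le_log (by positivity) hr
    rw [one_div, Real.log_inv] at this
    linarith
  have h1 : r ^ (-(Real.log (3 / 2) / Real.log D)) = (1 + 1 / 2) ^ θ := by
    rw [Real.rpow_def_of_pos hr0, Real.rpow_def_of_pos (by norm_num), hθ]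
    congr 1
    norm_num
    ring
  have h2 : r = (1 + (1 / D - 1)) ^ θ := by
    rw [Real.rpow_def_of_pos (by ring_nf; positivity), hθ]
    have : 1 + (1 / D - 1) = D⁻¹ := by ring
    rw [this, Real.log_inv]
    have : -Real.log D * (-Real.log r / Real.log D) = Real.log r := by field_simp
    rw [this, Real.exp_log hr0]
  have h3 : (1 + 1 / 2 : ℝ) ^ θ ≤ 1 + θ * (1 / 2) :=
    rpow_one_add_le_one_add_mul_self (by norm_num) hθ0 hθ1
  have h4 : r ≤ 1 + θ * (1 / D - 1) := by
    conv_lhs => rw [h2]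
    exact rpow_one_add_le_one_add_mul_self (by
      have : 0 < 1 / D := by positivity
      linarith) hθ0 hθ1
  have h5 : 1 / D ≤ 1 / 2 := one_div_le_one_div_of_le (by norm_num) hD
  rw [sub_eq_add_neg, Real.rpow_add hr0, Real.rpow_one, h1]
  refine mul_le_mul_of_nonneg_left ?_ hr0.le
  nlinarith

variable {V : Type*} [Fintype V] {G : SimpleGraph V} [DecidableRel G.Adj]

/-- By `rpow_sum_le_mul_sum_max` only indicators matter. If a fraction r of the neighbours is good,
one of two offers is good with probability r(2 - r), which `rpow_one_sub_le` compares with r^γ; a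
nonzero r is at least 1/D. -/
theorem nbrAvg_rpow_le {D : ℕ} (hD : 2 ≤ D) {x : V} (hx : 0 < G.degree x) (hxD : G.degree x ≤ D)
    {γ : ℝ} (hγ : γ = 1 - Real.log (3 / 2) / Real.log D) (hγ0 : 0 < γ) (hγ1 : γ ≤ 1)
    {f : V → ℝ} (hf : ∀ y, 0 ≤ f y) :
    nbrAvg G x f ^ γ ≤
      nbrAvg G x fun a => nbrAvg G x fun b => max (f a ^ γ) (f b ^ γ) := by
  have hd : (0 : ℝ) < G.degree x := by exact_mod_cast hx
  have hcard := G.card_neighborFinset_eq_degree x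
  have h := rpow_sum_le_mul_sum_max (G.neighborFinset x) (γ := γ)
    (K := (G.degree x : ℝ) ^ γ / (G.degree x : ℝ) ^ 2) hγ0 hγ1 ?_ (by positivity)
    (fun y => f y ^ γ) (fun y => Real.rpow_nonneg (hf y) _)
  · simp only [← Real.rpow_mul (hf _), mul_one_div_cancel hγ0.ne', Real.rpow_one] at h
    rw [nbrAvg, Real.div_rpow (Finset.sum_nonneg fun y _ => hf y) hd.le,
      div_le_iff₀ (Real.rpow_pos_of_pos hd _)]
    refine h.trans_eq ?_
    simp only [nbrAvg, ← Finset.sum_div]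
    field_simp
  · intro k hk
    rw [hcard] at hk ⊢
    rcases Nat.eq_zero_or_pos k with rfl | hk0
    · simp [Real.zero_rpow hγ0.ne']
    have hk0' : (0 : ℝ) < k := by exact_mod_cast hk0
    have hkd : (k : ℝ) ≤ G.degree x := by exact_mod_cast hk
    have h1 := rpow_one_sub_le (D := D) (r := k / G.degree x) (by exact_mod_cast hD) (by
      rw [div_le_div_iff₀ (by positivity) hd]
      have h1k : (1 : ℝ) ≤ k := by exact_mod_cast hk0
      have hdD : (G.degree x : ℝ) ≤ D := by exact_mod_cast hxD
      nlinarith) ((div_le_one hd).2 hkd)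
    rw [← hγ, Real.div_rpow hk0'.le hd.le, div_le_iff₀ (Real.rpow_pos_of_pos hd _)] at h1
    refine h1.trans_eq ?_
    field_simp
    ring

variable [DecidableEq V]

variable (G) in
/-- The probability that the simple random walk started from `x` visits `U` by time `t`. -/
noncomputable def hitProb (U : Finset V) : ℕ → V → ℝ
  | 0, x => if x ∈ U then 1 else 0
  | t + 1, x => if x ∈ U then 1 else nbrAvg G x (hitProb U t)

variable (G) in
/-- The largest probability with which a choice random walk started from `x` visits `U` by
time `t`. -/
noncomputable def boostedHitProb (U : Finset V) : ℕ → V → ℝ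
  | 0, x => if x ∈ U then 1 else 0
  | t + 1, x => if x ∈ U then 1 else nbrAvg G x fun a => nbrAvg G x fun b =>
      max (boostedHitProb U t a) (boostedHitProb U t b)

theorem hitProb_nonneg (U : Finset V) (t : ℕ) (x : V) : 0 ≤ hitProb G U t x := by
  induction t generalizing x with
  | zero => rw [hitProb]; split_ifs <;> norm_num
  | succ t ih =>
    rw [hitProb]
    split_ifs
    · norm_num
    · exact nbrAvg_nonneg ih

theorem hitProb_of_mem {U : Finset V} {x : V} (hx : x ∈ U) (t : ℕ) : hitProb G U t x = 1 := by
  cases t <;> simp [hitProb, hx]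

theorem boostedHitProb_of_mem {U : Finset V} {x : V} (hx : x ∈ U) (t : ℕ) :
    boostedHitProb G U t x = 1 := by
  cases t <;> simp [boostedHitProb, hx]

theorem boostedHitProb_le_one (hG : ∀ v, 0 < G.degree v) (U : Finset V) (t : ℕ) (x : V) :
    boostedHitProb G U t x ≤ 1 := by
  induction t generalizing x with
  | zero => rw [boostedHitProb]; split_ifs <;> norm_num
  | succ t ih =>
    rw [boostedHitProb]
    split_ifs
    · norm_num
    · exact nbrAvg_le (hG x) fun a => nbrAvg_le (hG x) fun b => max_le (ih a) (ih b)

theorem hitProb_le_succ (U : Finset V) (t : ℕ) (x : V) :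
    hitProb G U t x ≤ hitProb G U (t + 1) x := by
  induction t generalizing x with
  | zero =>
    rw [hitProb, hitProb]
    split_ifs
    · exact le_rfl
    · exact nbrAvg_nonneg (hitProb_nonneg U 0)
  | succ t ih =>
    rw [hitProb, hitProb]
    split_ifs
    · exact le_rfl
    · exact nbrAvg_mono ih

/-- The one-step inequality has the same exponent on both sides, so it iterates over time without
loss. -/
theorem hitProb_rpow_le_boostedHitProb (hG : ∀ v, 0 < G.degree v) {D : ℕ} (hD : 2 ≤ D)
    (hGD : ∀ v, G.degree v ≤ D) {γ : ℝ} (hγ : γ = 1 - Real.log (3 / 2) / Real.log D)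
    (hγ0 : 0 < γ) (hγ1 : γ ≤ 1) (U : Finset V) (t : ℕ) (x : V) :
    hitProb G U t x ^ γ ≤ boostedHitProb G U t x := by
  induction t generalizing x with
  | zero =>
    rw [hitProb, boostedHitProb]
    split_ifs
    · simp
    · simp [Real.zero_rpow hγ0.ne']
  | succ t ih =>
    rw [hitProb, boostedHitProb]
    split_ifs
    · simp
    · refine (nbrAvg_rpow_le hD (hG x) (hGD x) hγ hγ0 hγ1 (hitProb_nonneg U t)).trans ?_
      exact nbrAvg_mono fun a => nbrAvg_mono fun b => max_le_max (ih a) (ih b)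

end Boosting

/-! ### Bellman recursion for the cover time -/

section Bellman

variable {V : Type*} [Fintype V] [DecidableEq V] {G : SimpleGraph V} [DecidableRel G.Adj]

variable (G) in
/-- The least expected number of steps among the first `N` that a choice random walk started from
`x` makes before it has visited all of `U`. -/
noncomputable def optimalCost : ℕ → V → Finset V → ℝ
  | 0, _, _ => 0
  | N + 1, x, U => if U = ∅ then 0 else 1 + nbrAvg G x fun a => nbrAvg G x fun b =>
      min (optimalCost N a (U.erase a)) (optimalCost N b (U.erase b))

theorem optimalCost_nonneg (N : ℕ) (x : V) (U : Finset V) : 0 ≤ optimalCost G N x U := by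
  induction N generalizing x U with
  | zero => exact le_rfl
  | succ N ih =>
    rw [optimalCost]
    split_ifs
    · exact le_rfl
    · exact add_nonneg zero_le_one
        (nbrAvg_nonneg fun a => nbrAvg_nonneg fun b => le_min (ih _ _) (ih _ _))

theorem optimalCost_le_succ (N : ℕ) (x : V) (U : Finset V) :
    optimalCost G N x U ≤ optimalCost G (N + 1) x U := by
  induction N generalizing x U with
  | zero => exact optimalCost_nonneg _ _ _
  | succ N ih =>
    rw [optimalCost, optimalCost]
    split_ifs
    · exact le_rfl
    · gcongr
      exact nbrAvg_mono fun a => nbrAvg_mono fun b => min_le_min (ih _ _) (ih _ _)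

theorem optimalCost_le (hG : ∀ v, 0 < G.degree v) (N : ℕ) (x : V) (U : Finset V) :
    optimalCost G N x U ≤ N := by
  induction N generalizing x U with
  | zero => simp [optimalCost]
  | succ N ih =>
    rw [optimalCost]
    split_ifs
    · positivity
    · have := nbrAvg_le (G := G) (hG x) fun a => nbrAvg_le (hG x) fun b =>
        (min_le_left _ (optimalCost G N b (U.erase b))).trans (ih a (U.erase a))
      push_cast
      linarith

/-- Aim at `U` for t steps: with hitting probability p the cost is at most t + pA + (1 - p)B. This
is nonincreasing in p, so the minimum of costs over two offers matches the maximum in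
`boostedHitProb`. `hUA` covers all horizons because the hit may come at any of the t steps. -/
theorem optimalCost_add_le (hG : ∀ v, 0 < G.degree v) {U : Finset V} {A B : ℝ} (hA : 0 ≤ A)
    (hAB : A ≤ B) (hUA : ∀ N, ∀ y ∈ U, optimalCost G N y (U.erase y) ≤ A) (N : ℕ)
    (hUB : ∀ y ∉ U, optimalCost G N y U ≤ B) (t : ℕ) (x : V) :
    optimalCost G (N + t) x (U.erase x) ≤ t + B - boostedHitProb G U t x * (B - A) := by
  induction t generalizing x with
  | zero =>
    rw [boostedHitProb]
    split_ifs with hx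
    · have := hUA N x hx
      simp only [Nat.cast_zero, add_zero]
      linarith
    · rw [Finset.erase_eq_of_notMem hx]
      have := hUB x hx
      simp only [Nat.cast_zero, add_zero]
      linarith
  | succ t ih =>
    by_cases hx : x ∈ U
    · rw [boostedHitProb_of_mem hx]
      have := hUA (N + (t + 1)) x hx
      have : (0 : ℝ) ≤ (t + 1 : ℕ) := Nat.cast_nonneg _
      linarith
    · rw [Finset.erase_eq_of_notMem hx, boostedHitProb, if_neg hx, ← add_assoc, optimalCost]
      split_ifs with hU
      · have h1 : nbrAvg G x (fun a => nbrAvg G x fun b =>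
            max (boostedHitProb G U t a) (boostedHitProb G U t b)) ≤ 1 :=
          nbrAvg_le (hG x) fun a => nbrAvg_le (hG x) fun b =>
            max_le (boostedHitProb_le_one hG _ _ _) (boostedHitProb_le_one hG _ _ _)
        have : (0 : ℝ) ≤ (t + 1 : ℕ) := Nat.cast_nonneg _
        nlinarith
      · have h1 : nbrAvg G x (fun a => nbrAvg G x fun b =>
            min (optimalCost G (N + t) a (U.erase a)) (optimalCost G (N + t) b (U.erase b))) ≤
            nbrAvg G x (fun a => nbrAvg G x fun b => (t + B) + (-(B - A)) *
              max (boostedHitProb G U t a) (boostedHitProb G U t b)) := by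
          refine nbrAvg_mono fun a => nbrAvg_mono fun b => ?_
          have ha := ih a
          have hb := ih b
          rcases max_choice (boostedHitProb G U t a) (boostedHitProb G U t b) with h | h <;> rw [h]
          · exact (min_le_left _ _).trans (by linarith)
          · exact (min_le_right _ _).trans (by linarith)
        simp only [nbrAvg_add, nbrAvg_const (hG x), nbrAvg_const_mul] at h1
        push_cast
        linarith

/-- Geometric trials: each block of T steps succeeds with probability at least q. The value B = A +
T/q makes the bound of `optimalCost_add_le` reproduce itself. -/
theorem optimalCost_le_add_div (hG : ∀ v, 0 < G.degree v) {U : Finset V} {A q : ℝ} {T : ℕ}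
    (hA : 0 ≤ A) (hT : 0 < T) (hq : 0 < q) (hqU : ∀ y, q ≤ boostedHitProb G U T y)
    (hUA : ∀ N, ∀ y ∈ U, optimalCost G N y (U.erase y) ≤ A) (N : ℕ) {x : V} (hx : x ∉ U) :
    optimalCost G N x U ≤ A + T / q := by
  induction N using Nat.strong_induction_on generalizing x with
  | _ N ih =>
  have hTq : (T : ℝ) ≤ T / q := by
    rw [le_div_iff₀ hq]
    have := (hqU x).trans (boostedHitProb_le_one hG U T x)
    have : (0 : ℝ) ≤ T := Nat.cast_nonneg _
    nlinarith
  rcases le_or_gt N T with hN | hN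
  · have h1 := optimalCost_le hG N x U
    have h2 : (N : ℝ) ≤ T := by exact_mod_cast hN
    linarith
  · obtain ⟨M, rfl⟩ := Nat.exists_eq_add_of_lt hN
    -- T > 0 makes M + 1 a strictly smaller horizon, so the induction hypothesis applies.
    have h1 := optimalCost_add_le hG hA (B := A + T / q)
      (by linarith [(Nat.cast_nonneg T : (0 : ℝ) ≤ T)]) hUA (M + 1) (fun y hy => ih (M + 1) (by omega) hy) T x
    rw [Finset.erase_eq_of_notMem hx, show M + 1 + T = T + M + 1 by ring] at h1
    have h2 : q * (T / q) ≤ boostedHitProb G U T x * (T / q) :=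
      mul_le_mul_of_nonneg_right (hqU x) (by positivity)
    rw [mul_div_cancel₀ _ hq.ne'] at h2
    linarith

theorem optimalCost_le_sum (hG : ∀ v, 0 < G.degree v) {T : ℕ} (hT : 0 < T) {q : ℕ → ℝ}
    (hq : ∀ r, 0 < r → 0 < q r) (hqU : ∀ (U : Finset V) (y : V), U.Nonempty →
      q U.card ≤ boostedHitProb G U T y) (N : ℕ) {x : V} {U : Finset V} (hx : x ∉ U) :
    optimalCost G N x U ≤ ∑ r ∈ Finset.Icc 1 U.card, T / q r := by
  induction hn : U.card generalizing N x U with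
  | zero =>
    rw [Finset.card_eq_zero] at hn
    subst hn
    cases N <;> simp [optimalCost]
  | succ n ih =>
    rw [Finset.sum_Icc_succ_top (by omega)]
    refine optimalCost_le_add_div hG ?_ hT (hq (n + 1) n.succ_pos) (fun y => ?_) ?_ N hx
    · exact Finset.sum_nonneg fun r hr =>
        div_nonneg (Nat.cast_nonneg _) (hq r (Finset.mem_Icc.1 hr).1).le
    · rw [← hn]
      exact hqU U y (Finset.card_pos.1 (by omega))
    · intro N y hy
      exact ih N (Finset.notMem_erase y U) (by rw [Finset.card_erase_of_mem hy]; omega)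

/-- Always taking the first offer gives the simple random walk. A bound affine in the number of
unvisited vertices passes through expectations, which turn that number into a sum of survival
probabilities. -/
theorem optimalCost_add_le_avoidProb (hG : ∀ v, 0 < G.degree v) {N : ℕ} {α β : ℝ} (hα : 0 ≤ α)
    (hβ : 0 ≤ β) (hN : ∀ (y : V) (U : Finset V), y ∉ U → optimalCost G N y U ≤ α + β * U.card)
    (t : ℕ) (x : V) (U : Finset V) :
    optimalCost G (N + t) x (U.erase x) ≤ t + α + β * ∑ v ∈ U, avoidProb G v t x := by
  induction t generalizing x U with
  | zero =>
    refine (hN x (U.erase x) (Finset.notMem_erase _ _)).trans (le_of_eq ?_)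
    simp only [avoidProb, Nat.cast_zero, zero_add]
    congr 2
    have h1 : ∀ v ∈ U, (if x = v then (0 : ℝ) else 1) = if v ∈ U.erase x then 1 else 0 := by
      intro v hv
      by_cases h : x = v
      · simp [h]
      · rw [if_neg h, if_pos (Finset.mem_erase.2 ⟨Ne.symm h, hv⟩)]
    rw [Finset.sum_congr rfl h1, Finset.sum_ite_mem,
      Finset.inter_eq_right.2 (Finset.erase_subset _ _)]
    simp
  | succ t ih =>
    rw [← add_assoc, optimalCost]
    have hnn : 0 ≤ β * ∑ v ∈ U, avoidProb G v (t + 1) x :=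
      mul_nonneg hβ (Finset.sum_nonneg fun v _ => avoidProb_nonneg v _ x)
    split_ifs with hU
    · positivity
    · have h1 : nbrAvg G x (fun a => nbrAvg G x fun b => min
          (optimalCost G (N + t) a ((U.erase x).erase a))
          (optimalCost G (N + t) b ((U.erase x).erase b))) ≤
          nbrAvg G x fun a => (t + α) + β * ∑ v ∈ U.erase x, avoidProb G v t a :=
        nbrAvg_mono fun a => nbrAvg_le (hG x) fun b => (min_le_left _ _).trans (ih a (U.erase x))
      simp only [nbrAvg_add, nbrAvg_const (hG x), nbrAvg_const_mul] at h1
      rw [nbrAvg_sum] at h1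
      have h2 : ∑ v ∈ U.erase x, nbrAvg G x (avoidProb G v t) ≤
          ∑ v ∈ U, avoidProb G v (t + 1) x := by
        refine (le_of_eq (Finset.sum_congr rfl fun v hv => ?_)).trans
          (Finset.sum_le_sum_of_subset_of_nonneg (Finset.erase_subset x U)
            fun v _ _ => avoidProb_nonneg v _ x)
        rw [avoidProb, if_neg (Finset.ne_of_mem_erase hv).symm]
      have h3 := mul_le_mul_of_nonneg_left h2 hβ
      push_cast
      linarith

variable [MeasurableSpace V] [DiscreteMeasurableSpace V]

/-- Costs increase with the horizon, and their limit solves the untruncated Bellman equation, so it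
serves as potential for the greedy strategy. `hM` only makes the limit finite; the bound comes from
`hB`. -/
theorem crwCoverTime_le_of_optimalCost_le (hG : ∀ v, 0 < G.degree v) {B : ℝ}
    (hB : ∀ N x, optimalCost G N x (Finset.univ.erase x) ≤ B)
    {M : ℝ} (hM : ∀ N x U, x ∉ U → optimalCost G N x U ≤ M) :
    crwCoverTime G ≤ ENNReal.ofReal B := by
  have hbdd : ∀ x U, BddAbove (Set.range fun N => optimalCost G N x U) := by
    -- `hM` is silent when x ∈ U, but after one step the position a lies outside `U.erase a`; hence
    -- 1 + M.
    refine fun x U => ⟨max 0 (1 + M), ?_⟩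
    rintro _ ⟨N, rfl⟩
    refine (optimalCost_le_succ N x U).trans ?_
    rw [optimalCost]
    split_ifs
    · exact le_max_left _ _
    · refine le_max_of_le_right (add_le_add_right ?_ 1)
      exact nbrAvg_le (hG x) fun a => nbrAvg_le (hG x) fun b =>
        (min_le_left _ _).trans (hM N a _ (Finset.notMem_erase a U))
  set W : V → Finset V → ℝ := fun x U => ⨆ N, optimalCost G N x U with hW
  have hlim : ∀ x U, Filter.Tendsto (fun N => optimalCost G N x U) Filter.atTop (nhds (W x U)) :=
    fun x U => tendsto_atTop_ciSup (monotone_nat_of_le_succ fun N => optimalCost_le_succ N x U)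
      (hbdd x U)
  have hW0 : ∀ x U, 0 ≤ W x U := fun x U =>
    (optimalCost_nonneg 0 x U).trans (le_ciSup (hbdd x U) 0)
  have hWstep : ∀ x U, U ≠ ∅ → 1 + nbrAvg G x (fun a => nbrAvg G x fun b =>
      min (W a (U.erase a)) (W b (U.erase b))) ≤ W x U := by
    intro x U hU
    have h1 : Filter.Tendsto (fun N => optimalCost G (N + 1) x U) Filter.atTop
        (nhds (1 + nbrAvg G x (fun a => nbrAvg G x fun b =>
          min (W a (U.erase a)) (W b (U.erase b))))) := by
      simp only [optimalCost, if_neg hU]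
      refine tendsto_const_nhds.add ?_
      simp only [nbrAvg]
      refine Filter.Tendsto.div_const (tendsto_finsetSum _ fun a _ => ?_) _
      refine Filter.Tendsto.div_const (tendsto_finsetSum _ fun b _ => ?_) _
      exact (hlim a _).min (hlim b _)
    exact le_of_eq (tendsto_nhds_unique h1 ((Filter.tendsto_add_atTop_iff_nat 1).2 (hlim x U)))
  have hΦ : ∀ x U, (if U = ∅ then 0 else 1) + ∑' c, randomOffer G x c *
      offerMin (fun w => ENNReal.ofReal (if U.erase w = ∅ then 0 else W w (U.erase w))) c ≤
      ENNReal.ofReal (if U = ∅ then 0 else W x U) := by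
    intro x U
    have hW0' : ∀ w, 0 ≤ if U.erase w = ∅ then 0 else W w (U.erase w) := fun w => by
      split_ifs; exacts [le_rfl, hW0 _ _]
    rw [tsum_randomOffer_mul (hG x) (f := fun w => if U.erase w = ∅ then 0 else W w (U.erase w)) hW0']
    by_cases hU : U = ∅
    · subst hU
      simp [nbrAvg]
    · rw [if_neg hU, if_neg hU, ← ENNReal.ofReal_one, ← ENNReal.ofReal_add zero_le_one
        (nbrAvg_nonneg fun a => nbrAvg_nonneg fun b => le_min (hW0' a) (hW0' b))]
      refine ENNReal.ofReal_le_ofReal (le_trans ?_ (hWstep x U hU))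
      gcongr
      refine nbrAvg_mono fun a => nbrAvg_mono fun b => min_le_min ?_ ?_
      · split_ifs; exacts [hW0 _ _, le_rfl]
      · split_ifs; exacts [hW0 _ _, le_rfl]
  refine iSup_le fun x => ?_
  obtain ⟨σ, hσ⟩ := exists_strategy_lintegral_coverTime_le (G := G)
    (fun x U => ENNReal.ofReal (if U = ∅ then 0 else W x U)) hΦ x
  refine (iInf_le _ σ).trans (hσ.trans (ENNReal.ofReal_le_ofReal ?_))
  split_ifs with h
  · exact (optimalCost_nonneg 0 x _).trans (hB 0 x)
  · exact ciSup_le fun N => hB N x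

end Bellman

/-! ### Survival probabilities of the simple random walk -/

section Avoid

variable {V : Type*} [Fintype V] [DecidableEq V] {G : SimpleGraph V} [DecidableRel G.Adj]

theorem avoidProb_le_one (hG : ∀ v, 0 < G.degree v) (y : V) (t : ℕ) (x : V) :
    avoidProb G y t x ≤ 1 := by
  induction t generalizing x with
  | zero => rw [avoidProb]; split_ifs <;> norm_num
  | succ t ih =>
    rw [avoidProb]
    split_ifs
    · norm_num
    · exact nbrAvg_le (hG x) ih

theorem avoidProb_antitone (hG : ∀ v, 0 < G.degree v) (y x : V) :
    Antitone fun t => avoidProb G y t x := by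
  refine antitone_nat_of_succ_le fun t => ?_
  induction t generalizing x with
  | zero =>
    rw [avoidProb, avoidProb]
    split_ifs
    · exact le_rfl
    · exact nbrAvg_le (hG x) (avoidProb_le_one hG y 0)
  | succ t ih =>
    rw [avoidProb, avoidProb]
    split_ifs
    · exact le_rfl
    · exact nbrAvg_mono ih

/-- The Markov property: wherever the walk is after s steps, it survives m more with probability at
most c. -/
theorem avoidProb_add_le {y : V} {m : ℕ} {c : ℝ} (hc : ∀ x, avoidProb G y m x ≤ c) (s : ℕ) (x : V) :
    avoidProb G y (s + m) x ≤ c * avoidProb G y s x := by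
  induction s generalizing x with
  | zero =>
    by_cases h : x = y
    · simp [h]
    · simpa [avoidProb, h] using hc x
  | succ s ih =>
    rw [show s + 1 + m = s + m + 1 by ring, avoidProb, avoidProb]
    split_ifs
    · simp
    · exact (nbrAvg_mono ih).trans_eq (nbrAvg_const_mul _ _)

theorem avoidProb_mul_le_pow (hG : ∀ v, 0 < G.degree v) {y : V} {m : ℕ} {c : ℝ} (hc0 : 0 ≤ c)
    (hc : ∀ x, avoidProb G y m x ≤ c) (k : ℕ) (x : V) : avoidProb G y (k * m) x ≤ c ^ k := by
  induction k with
  | zero => simpa using avoidProb_le_one hG y 0 x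
  | succ k ih =>
    rw [Nat.succ_mul, pow_succ']
    exact (avoidProb_add_le hc _ x).trans (mul_le_mul_of_nonneg_left ih hc0)

/-- In t steps the walk sees at most t + 1 vertices; in the recursion, each step drops one term of
size at most 1. -/
theorem card_sub_le_sum_avoidProb (hG : ∀ v, 0 < G.degree v) (t : ℕ) (x : V) :
    (Fintype.card V : ℝ) - 1 - t ≤ ∑ y, avoidProb G y t x := by
  induction t generalizing x with
  | zero =>
    simp only [avoidProb]
    have h1 : ∀ y, (if x = y then (0 : ℝ) else 1) = 1 - if x = y then 1 else 0 := by
      intro y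
      split_ifs <;> norm_num
    simp [h1]
  | succ t ih =>
    have h1 : nbrAvg G x (fun w => ((Fintype.card V : ℝ) - 1 - t) + (-1)) ≤
        nbrAvg G x (fun w => ∑ y ∈ Finset.univ.erase x, avoidProb G y t w) := by
      refine nbrAvg_mono fun w => ?_
      have h2 := ih w
      rw [← Finset.add_sum_erase _ _ (Finset.mem_univ x)] at h2
      linarith [avoidProb_le_one hG x t w]
    rw [nbrAvg_const (hG x), nbrAvg_sum] at h1
    have h2 : ∑ y ∈ Finset.univ.erase x, nbrAvg G x (avoidProb G y t) ≤
        ∑ y, avoidProb G y (t + 1) x := by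
      refine (le_of_eq (Finset.sum_congr rfl fun v hv => ?_)).trans
        (Finset.sum_le_sum_of_subset_of_nonneg (Finset.erase_subset x _)
          fun v _ _ => avoidProb_nonneg v _ x)
      rw [avoidProb, if_neg (Finset.ne_of_mem_erase hv).symm]
    push_cast
    linarith

end Avoid

/-! ### Spectral gap and mixing of the lazy walk -/

section Spectral

open Matrix

variable {V : Type*} [Fintype V] [DecidableEq V] {G : SimpleGraph V} [DecidableRel G.Adj]

theorem lazyMatrix_mulVec_apply (g : V → ℝ) (x : V) :
    (lazyMatrix G *ᵥ g) x = g x / 2 + nbrAvg G x g / 2 := by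
  simp only [lazyMatrix, mulVec, dotProduct, of_apply, add_mul, ite_mul, zero_mul,
    Finset.sum_add_distrib, Finset.sum_ite_eq, Finset.mem_univ, if_true]
  congr 1
  · ring
  · rw [nbrAvg, ← Finset.sum_filter, ← G.neighborFinset_eq_filter, ← Finset.mul_sum]
    field_simp

/-- Being in `U` at time t implies having visited it, and holding steps only delay a visit because
hitting probabilities grow with time. -/
theorem lazyMatrix_pow_mulVec_le_hitProb (hG : ∀ v, 0 < G.degree v) (U : Finset V) (t : ℕ) (x : V) :
    (lazyMatrix G ^ t *ᵥ fun y => if y ∈ U then 1 else 0) x ≤ hitProb G U t x := by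
  induction t generalizing x with
  | zero => simp [hitProb]
  | succ t ih =>
    rw [pow_succ', ← mulVec_mulVec, lazyMatrix_mulVec_apply]
    have h1 : nbrAvg G x (lazyMatrix G ^ t *ᵥ fun y => if y ∈ U then 1 else 0) ≤
        nbrAvg G x (hitProb G U t) := nbrAvg_mono ih
    have h2 := ih x
    by_cases hx : x ∈ U
    · have h3 : nbrAvg G x (hitProb G U t) ≤ 1 := by
        refine nbrAvg_le (hG x) fun y => ?_
        clear h1 h2 ih
        induction t generalizing y with
        | zero => rw [hitProb]; split_ifs <;> norm_num
        | succ t ih =>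
          rw [hitProb]
          split_ifs
          · norm_num
          · exact nbrAvg_le (hG y) ih
      rw [hitProb_of_mem hx] at h2 ⊢
      linarith
    · have h3 := hitProb_le_succ (G := G) U t x
      have h4 : hitProb G U (t + 1) x = nbrAvg G x (hitProb G U t) := by rw [hitProb, if_neg hx]
      linarith

variable (G) in
/-- The symmetric matrix that is conjugate to the transition matrix of the lazy random walk. -/
noncomputable def symLazyMatrix : Matrix V V ℝ :=
  of fun x y => (if x = y then 1 / 2 else 0) +
    (if G.Adj x y then 1 / (2 * (√(G.degree x) * √(G.degree y))) else 0)

theorem isHermitian_symLazyMatrix : (symLazyMatrix G).IsHermitian := by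
  ext x y
  simp only [symLazyMatrix, conjTranspose_apply, of_apply, star_trivial, G.adj_comm y x,
    eq_comm (a := y), mul_comm (√(G.degree y : ℝ))]

variable (G) in
/-- The diagonal matrix of the square roots of the degrees. -/
noncomputable def sqrtDegMatrix : Matrix V V ℝ := diagonal fun x => √(G.degree x)

theorem sqrtDegMatrix_mul_lazyMatrix (hG : ∀ v, 0 < G.degree v) :
    sqrtDegMatrix G * lazyMatrix G = symLazyMatrix G * sqrtDegMatrix G := by
  ext x y
  have hx : (0 : ℝ) < √(G.degree x) := Real.sqrt_pos.2 (by exact_mod_cast hG x)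
  have hy : (0 : ℝ) < √(G.degree y) := Real.sqrt_pos.2 (by exact_mod_cast hG y)
  simp only [sqrtDegMatrix, lazyMatrix, symLazyMatrix, diagonal_mul, mul_diagonal, of_apply]
  rw [mul_add, add_mul]
  congr 1
  · by_cases h : x = y
    · subst h; simp [mul_comm]
    · simp [h]
  · split_ifs
    · have : (G.degree x : ℝ) = √(G.degree x) * √(G.degree x) :=
        (Real.mul_self_sqrt (Nat.cast_nonneg _)).symm
      field_simp
      rw [sq, ← this, div_self (by rw [this]; positivity)]
    · simp

/-- Lets `lambdaTwo`, defined from a matrix that need not be symmetric, be read off the spectral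
theorem. -/
theorem charpoly_lazyMatrix (hG : ∀ v, 0 < G.degree v) :
    (lazyMatrix G).charpoly = (symLazyMatrix G).charpoly := by
  have hne : ∀ x, √(G.degree x : ℝ) ≠ 0 := fun x =>
    (Real.sqrt_pos.2 (by exact_mod_cast hG x)).ne'
  let M : (Matrix V V ℝ)ˣ := ⟨sqrtDegMatrix G, diagonal fun x => (√(G.degree x))⁻¹,
    by simp [sqrtDegMatrix, hne], by simp [sqrtDegMatrix, hne]⟩
  rw [← charpoly_units_conj M (lazyMatrix G)]
  congr 1
  have h1 : (M : Matrix V V ℝ) * lazyMatrix G = symLazyMatrix G * (M : Matrix V V ℝ) :=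
    sqrtDegMatrix_mul_lazyMatrix hG
  rw [h1, Matrix.mul_assoc, ← coe_units_inv, Units.mul_inv, Matrix.mul_one]

theorem symLazyMatrix_pow_mulVec (hG : ∀ v, 0 < G.degree v) (t : ℕ) (g : V → ℝ) (x : V) :
    (symLazyMatrix G ^ t *ᵥ fun y => √(G.degree y) * g y) x =
      √(G.degree x) * (lazyMatrix G ^ t *ᵥ g) x := by
  have hcomm : ∀ t : ℕ, sqrtDegMatrix G * lazyMatrix G ^ t =
      symLazyMatrix G ^ t * sqrtDegMatrix G := by
    intro t
    induction t with
    | zero => simp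
    | succ t ih =>
      rw [pow_succ, ← Matrix.mul_assoc, ih, Matrix.mul_assoc, sqrtDegMatrix_mul_lazyMatrix hG,
        ← Matrix.mul_assoc, pow_succ]
  have hE : ∀ g : V → ℝ, sqrtDegMatrix G *ᵥ g = fun y => √(G.degree y) * g y := by
    intro g
    ext y
    rw [sqrtDegMatrix, mulVec_diagonal]
  rw [← hE, mulVec_mulVec, ← hcomm, ← mulVec_mulVec, hE]

/-- Maximum principle where |f/√deg| is largest: neighbour averaging is a contraction, so |2μ - 1| ≤
1. Laziness is what makes μ ≥ 0. -/
theorem eigenvalue_mem_Icc_of_symLazyMatrix (hG : ∀ v, 0 < G.degree v) {f : V → ℝ} {μ : ℝ}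
    (hf : symLazyMatrix G *ᵥ f = μ • f) (hf0 : f ≠ 0) : 0 ≤ μ ∧ μ ≤ 1 := by
  have hpos : ∀ x, 0 < √(G.degree x : ℝ) := fun x => Real.sqrt_pos.2 (by exact_mod_cast hG x)
  set g : V → ℝ := fun x => f x / √(G.degree x) with hg
  have hfg : f = fun y => √(G.degree y) * g y := by
    ext y
    simp only [hg]
    rw [mul_div_cancel₀ _ (hpos y).ne']
  have hK : ∀ x, g x / 2 + nbrAvg G x g / 2 = μ * g x := by
    intro x
    have h1 := symLazyMatrix_pow_mulVec hG 1 g x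
    rw [pow_one, pow_one, ← hfg, hf, lazyMatrix_mulVec_apply, Pi.smul_apply, smul_eq_mul, hfg] at h1
    have h2 := (hpos x).ne'
    have h3 : √(G.degree x : ℝ) * (g x / 2 + nbrAvg G x g / 2) = √(G.degree x : ℝ) * (μ * g x) := by
      rw [← h1]; ring
    exact mul_left_cancel₀ h2 h3
  obtain ⟨y, hy⟩ := Function.ne_iff.1 hf0
  obtain ⟨x, -, hx⟩ := Finset.exists_max_image Finset.univ (fun x => |g x|) ⟨y, Finset.mem_univ y⟩
  have hgx : 0 < |g x| := lt_of_lt_of_le (abs_pos.2 (div_ne_zero hy (hpos y).ne'))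
    (hx y (Finset.mem_univ y))
  have h1 : nbrAvg G x g ≤ |g x| := nbrAvg_le (hG x) fun y =>
    (le_abs_self _).trans (hx y (Finset.mem_univ y))
  have h2 : -|g x| ≤ nbrAvg G x g := by
    rw [← nbrAvg_const (G := G) (hG x) (-|g x|)]
    exact nbrAvg_mono fun y => neg_le.1 ((neg_le_abs _).trans (hx y (Finset.mem_univ y)))
  have h3 := hK x
  have h4 : |(2 * μ - 1) * g x| ≤ |g x| := by
    rw [abs_le]
    constructor <;> linarith
  rw [abs_mul] at h4
  have h5 : |2 * μ - 1| ≤ 1 := by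
    by_contra h
    push Not at h
    nlinarith
  rw [abs_le] at h5
  constructor <;> linarith [h5.1, h5.2]

/-- Divided by √deg, a fixed vector is harmonic, so it lies in the kernel of the Laplacian, which is
constant on a connected graph. -/
theorem eq_const_of_symLazyMatrix_mulVec_eq_self (hG : ∀ v, 0 < G.degree v) (hconn : G.Connected)
    {f : V → ℝ} (hf : symLazyMatrix G *ᵥ f = f) : ∃ c : ℝ, ∀ x, f x = c * √(G.degree x) := by
  have hpos : ∀ x, 0 < √(G.degree x : ℝ) := fun x => Real.sqrt_pos.2 (by exact_mod_cast hG x)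
  set g : V → ℝ := fun x => f x / √(G.degree x) with hg
  have hfg : f = fun y => √(G.degree y) * g y := by
    ext y
    simp only [hg]
    rw [mul_div_cancel₀ _ (hpos y).ne']
  have hlap : G.lapMatrix ℝ *ᵥ g = 0 := by
    ext x
    have h1 := symLazyMatrix_pow_mulVec hG 1 g x
    rw [pow_one, pow_one, ← hfg, hf, lazyMatrix_mulVec_apply, hfg] at h1
    have h2 := mul_left_cancel₀ (hpos x).ne' h1
    have hd : (0 : ℝ) < G.degree x := by exact_mod_cast hG x
    have h3 : nbrAvg G x g = g x := by linarith
    rw [nbrAvg, div_eq_iff hd.ne'] at h3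
    rw [SimpleGraph.lapMatrix_mulVec_apply, h3, Pi.zero_apply]
    ring
  obtain ⟨x₀⟩ := hconn.nonempty
  refine ⟨g x₀, fun x => ?_⟩
  rw [(SimpleGraph.lapMatrix_mulVec_eq_zero_iff_forall_reachable G).1 hlap x₀ x (hconn x₀ x), hfg,
    mul_comm]

theorem symLazyMatrix_mulVec_sqrt_degree (hG : ∀ v, 0 < G.degree v) :
    symLazyMatrix G *ᵥ (fun x => √(G.degree x)) = fun x => √(G.degree x) := by
  ext x
  have h1 := symLazyMatrix_pow_mulVec hG 1 (fun _ => 1) x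
  simp only [pow_one, mul_one] at h1
  rw [h1, lazyMatrix_mulVec_apply, nbrAvg_const (hG x)]
  ring

/-- The top eigenvalue of the lazy random walk on a connected graph is simple, and `lambdaTwo`
bounds all others. -/
theorem exists_top_eigenvector (hG : ∀ v, 0 < G.degree v) (hconn : G.Connected)
    (hn : 2 ≤ Fintype.card V) :
    ∃ i₀ : V, (isHermitian_symLazyMatrix (G := G)).eigenvalues i₀ = 1 ∧
      (∃ c : ℝ, ∀ x, (isHermitian_symLazyMatrix (G := G)).eigenvectorBasis i₀ x =
        c * √(G.degree x)) ∧
      (∀ i ≠ i₀, 0 ≤ (isHermitian_symLazyMatrix (G := G)).eigenvalues i ∧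
        (isHermitian_symLazyMatrix (G := G)).eigenvalues i ≤ lambdaTwo G) ∧
      0 ≤ lambdaTwo G ∧ lambdaTwo G < 1 := by
  set hS := isHermitian_symLazyMatrix (G := G) with hSdef
  set b := hS.eigenvectorBasis with hb
  have hbne : ∀ i, (b i : V → ℝ) ≠ 0 := by
    intro i h
    apply b.toBasis.ne_zero i
    ext x
    simpa using congrFun h x
  have hIcc : ∀ i, 0 ≤ hS.eigenvalues i ∧ hS.eigenvalues i ≤ 1 := fun i =>
    eigenvalue_mem_Icc_of_symLazyMatrix hG (hS.mulVec_eigenvectorBasis i) (hbne i)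
  have hconst : ∀ i, hS.eigenvalues i = 1 → ∃ c : ℝ, ∀ x, b i x = c * √(G.degree x) := by
    intro i hi
    refine eq_const_of_symLazyMatrix_mulVec_eq_self hG hconn ?_
    have := hS.mulVec_eigenvectorBasis i
    rwa [hi, one_smul] at this
  obtain ⟨x₀⟩ := hconn.nonempty
  -- Otherwise the fixed vector √deg would be orthogonal to the whole eigenbasis.
  have hex : ∃ i, hS.eigenvalues i = 1 := by
    by_contra hcon
    push Not at hcon
    set v : EuclideanSpace ℝ V := WithLp.toLp 2 fun x => √(G.degree x : ℝ) with hv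
    have hzero : ∀ i, inner ℝ (b i) v = 0 := by
      intro i
      have h1 : (b i : V → ℝ) ⬝ᵥ (symLazyMatrix G *ᵥ fun x => √(G.degree x : ℝ)) =
          (symLazyMatrix G *ᵥ (b i : V → ℝ)) ⬝ᵥ fun x => √(G.degree x : ℝ) := by
        rw [dotProduct_mulVec, ← mulVec_transpose]
        congr 2
      rw [symLazyMatrix_mulVec_sqrt_degree hG, hS.mulVec_eigenvectorBasis, smul_dotProduct,
        smul_eq_mul] at h1
      have h2 : (1 - hS.eigenvalues i) * ((b i : V → ℝ) ⬝ᵥ fun x => √(G.degree x : ℝ)) = 0 := by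
        rw [sub_mul, one_mul, sub_eq_zero]; exact h1
      have h3 := (mul_eq_zero.1 h2).resolve_left (sub_ne_zero.2 (hcon i).symm)
      rw [EuclideanSpace.inner_eq_star_dotProduct, dotProduct_comm]
      exact h3
    have hv0 : v = 0 := by
      rw [← b.sum_repr' v]
      exact Finset.sum_eq_zero fun i _ => by rw [hzero i, zero_smul]
    have : √(G.degree x₀ : ℝ) = 0 := congrArg (fun w : EuclideanSpace ℝ V => w x₀) hv0
    exact (Real.sqrt_pos.2 (by exact_mod_cast hG x₀)).ne' this
  obtain ⟨i₀, hi₀⟩ := hex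
  -- Two such eigenvectors would be nonzero multiples of √deg, which are not orthogonal.
  have huniq : ∀ i, hS.eigenvalues i = 1 → i = i₀ := by
    intro i hi
    by_contra hne
    obtain ⟨c, hc⟩ := hconst i hi
    obtain ⟨c₀, hc₀⟩ := hconst i₀ hi₀
    have horth : inner ℝ (b i) (b i₀) = 0 := b.orthonormal.2 hne
    rw [EuclideanSpace.inner_eq_star_dotProduct] at horth
    have h1 : c₀ * c * ∑ x, (G.degree x : ℝ) = 0 := by
      rw [← horth, Finset.mul_sum]
      refine Finset.sum_congr rfl fun x _ => ?_
      rw [Pi.star_apply, star_trivial, hc, hc₀]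
      nth_rw 1 [← Real.mul_self_sqrt (Nat.cast_nonneg (G.degree x) : (0 : ℝ) ≤ _)]
      ring
    have h2 : (0 : ℝ) < ∑ x, (G.degree x : ℝ) :=
      Finset.sum_pos (fun x _ => by exact_mod_cast hG x) ⟨x₀, Finset.mem_univ _⟩
    rcases mul_eq_zero.1 ((mul_eq_zero.1 h1).resolve_right h2.ne') with h | h
    · exact hbne i₀ (funext fun x => by rw [hc₀, h, zero_mul]; rfl)
    · exact hbne i (funext fun x => by rw [hc, h, zero_mul]; rfl)
  set e := (Fintype.equivOfCardEq (Fintype.card_fin (Fintype.card V)) : Fin _ ≃ V) with he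
  have heig : ∀ i, hS.eigenvalues i = hS.eigenvalues₀ (e.symm i) := fun i => rfl
  -- There are at least two roots, so the default value in `lambdaTwo` is not used.
  have hlam : lambdaTwo G = hS.eigenvalues₀ ⟨1, hn⟩ := by
    have h1 := hS.sort_roots_charpoly_eq_eigenvalues₀
    have h2 : (symLazyMatrix G).charpoly.roots.map (RCLike.re : ℝ → ℝ) =
        (symLazyMatrix G).charpoly.roots := by
      conv_rhs => rw [← Multiset.map_id (symLazyMatrix G).charpoly.roots]
      rfl
    rw [h2] at h1
    rw [lambdaTwo, charpoly_lazyMatrix hG, h1, List.getD_eq_getElem?_getD, List.getElem?_ofFn,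
      dif_pos (by omega)]
    rfl
  have hzero : e.symm i₀ = ⟨0, by omega⟩ := by
    have h1 : hS.eigenvalues (e ⟨0, by omega⟩) = 1 := by
      refine le_antisymm (hIcc _).2 ?_
      rw [← hi₀, heig, heig, Equiv.symm_apply_apply]
      exact hS.eigenvalues₀_antitone (Fin.mk_le_of_le_val (Nat.zero_le _))
    rw [← huniq _ h1, Equiv.symm_apply_apply]
  have hlam' : lambdaTwo G = hS.eigenvalues (e ⟨1, hn⟩) := by
    rw [hlam, heig, Equiv.symm_apply_apply]
  refine ⟨i₀, hi₀, hconst i₀ hi₀, fun i hi => ⟨(hIcc i).1, ?_⟩, ?_, ?_⟩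
  · rw [hlam, heig]
    refine hS.eigenvalues₀_antitone ?_
    have h1 : e.symm i ≠ ⟨0, by omega⟩ := fun h => hi (e.symm.injective (h.trans hzero.symm))
    have h2 : (e.symm i).val ≠ 0 := fun h => h1 (Fin.ext h)
    exact Fin.mk_le_of_le_val (by omega)
  · rw [hlam']; exact (hIcc _).1
  · rw [hlam']
    refine lt_of_le_of_ne (hIcc _).2 fun h => ?_
    have h1 := huniq _ h
    rw [← h1, Equiv.symm_apply_apply, Fin.mk.injEq] at hzero
    omega

/-- Expand √deg·1_U in the eigenbasis. The top eigenvector contributes the stationary measure of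
`U`; Cauchy–Schwarz and Parseval bound the rest by λ₂^t times the norm of √deg·1_U. Dividing the
error by √deg(x) ≥ 1 only helps. -/
theorem lazyMatrix_pow_mulVec_ge (hG : ∀ v, 0 < G.degree v) (hconn : G.Connected)
    (hn : 2 ≤ Fintype.card V) (U : Finset V) (t : ℕ) (x : V) :
    (∑ y ∈ U, (G.degree y : ℝ)) / (∑ y, (G.degree y : ℝ)) -
        lambdaTwo G ^ t * √(∑ y ∈ U, (G.degree y : ℝ)) ≤
      (lazyMatrix G ^ t *ᵥ fun y => if y ∈ U then 1 else 0) x := by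
  obtain ⟨i₀, hi₀, ⟨c, hc⟩, hle, hl0, -⟩ := exists_top_eigenvector hG hconn hn
  set hS := isHermitian_symLazyMatrix (G := G) with hSdef
  set b := hS.eigenvectorBasis with hb
  have hposx : 0 < √(G.degree x : ℝ) := Real.sqrt_pos.2 (by exact_mod_cast hG x)
  have hone : 1 ≤ √(G.degree x : ℝ) := by
    rw [Real.one_le_sqrt]; exact_mod_cast hG x
  set v : EuclideanSpace ℝ V :=
    WithLp.toLp 2 fun y => √(G.degree y) * if y ∈ U then 1 else 0 with hv
  set d := ∑ y ∈ U, (G.degree y : ℝ) with hd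
  have hsq : ∀ y, √(G.degree y : ℝ) * √(G.degree y : ℝ) = G.degree y := fun y =>
    Real.mul_self_sqrt (Nat.cast_nonneg _)
  have hpow : ∀ i, symLazyMatrix G ^ t *ᵥ (b i : V → ℝ) = hS.eigenvalues i ^ t • (b i : V → ℝ) := by
    intro i
    induction t with
    | zero => simp
    | succ t ih =>
      rw [pow_succ', ← mulVec_mulVec, ih, mulVec_smul, hS.mulVec_eigenvectorBasis, smul_smul,
        pow_succ]
  have hexp : √(G.degree x : ℝ) * (lazyMatrix G ^ t *ᵥ fun y => if y ∈ U then 1 else 0) x =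
      ∑ i, inner ℝ (b i) v * (hS.eigenvalues i ^ t * b i x) := by
    rw [← symLazyMatrix_pow_mulVec hG]
    have h1 : (fun y => √(G.degree y : ℝ) * if y ∈ U then 1 else 0) =
        ∑ i, inner ℝ (b i) v • (b i : V → ℝ) := by
      have h2 := congrArg (WithLp.ofLp (p := 2)) (b.sum_repr' v)
      rw [WithLp.ofLp_sum] at h2
      exact h2.symm
    rw [h1, mulVec_sum, Finset.sum_apply]
    refine Finset.sum_congr rfl fun i _ => ?_
    rw [mulVec_smul, hpow, Pi.smul_apply, Pi.smul_apply, smul_eq_mul, smul_eq_mul]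
  have hnormv : ‖v‖ ^ 2 = d := by
    rw [EuclideanSpace.norm_sq_eq, hd, ← Finset.univ_inter U, ← Finset.sum_ite_mem]
    refine Finset.sum_congr rfl fun y _ => ?_
    simp only [hv]
    split_ifs
    · rw [mul_one, Real.norm_eq_abs, sq_abs, sq, hsq]
    · simp
  have hc2 : c ^ 2 * ∑ y, (G.degree y : ℝ) = 1 := by
    have h1 : ‖b i₀‖ ^ 2 = 1 := by rw [b.orthonormal.1 i₀, one_pow]
    rw [EuclideanSpace.norm_sq_eq] at h1
    rw [← h1, Finset.mul_sum]
    refine Finset.sum_congr rfl fun y _ => ?_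
    rw [hc, Real.norm_eq_abs, sq_abs, mul_pow, sq (√_), hsq]
  have hvol : (∑ y, (G.degree y : ℝ)) ≠ 0 := fun h => by rw [h, mul_zero] at hc2; norm_num at hc2
  have hinner : inner ℝ (b i₀) v = c * d := by
    rw [EuclideanSpace.inner_eq_star_dotProduct, hd, dotProduct, Finset.mul_sum,
      ← Finset.univ_inter U, ← Finset.sum_ite_mem]
    refine Finset.sum_congr rfl fun y _ => ?_
    rw [Pi.star_apply, star_trivial, hc]
    simp only [hv]
    split_ifs
    · rw [mul_one, mul_comm, mul_assoc, hsq]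
    · simp
  have hmain : inner ℝ (b i₀) v * (hS.eigenvalues i₀ ^ t * b i₀ x) =
      √(G.degree x : ℝ) * (d / ∑ y, (G.degree y : ℝ)) := by
    rw [hinner, hi₀, one_pow, one_mul, hc]
    field_simp
    linear_combination d * hc2
  have hrest : -(lambdaTwo G ^ t * √d) ≤
      ∑ i ∈ Finset.univ.erase i₀, inner ℝ (b i) v * (hS.eigenvalues i ^ t * b i x) := by
    have h1 : ∑ i ∈ Finset.univ.erase i₀, -(lambdaTwo G ^ t * (|inner ℝ (b i) v| * |b i x|)) ≤
        ∑ i ∈ Finset.univ.erase i₀, inner ℝ (b i) v * (hS.eigenvalues i ^ t * b i x) := by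
      refine Finset.sum_le_sum fun i hi => ?_
      obtain ⟨h2, h3⟩ := hle i (Finset.ne_of_mem_erase hi)
      have h4 : hS.eigenvalues i ^ t ≤ lambdaTwo G ^ t := pow_le_pow_left₀ h2 h3 t
      have h5 : |inner ℝ (b i) v * (hS.eigenvalues i ^ t * b i x)| ≤
          lambdaTwo G ^ t * (|inner ℝ (b i) v| * |b i x|) := by
        rw [abs_mul, abs_mul, abs_of_nonneg (pow_nonneg h2 t)]
        calc _ = hS.eigenvalues i ^ t * (|inner ℝ (b i) v| * |b i x|) := by ring
          _ ≤ _ := mul_le_mul_of_nonneg_right h4 (by positivity)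
      exact (abs_le.1 h5).1
    refine le_trans ?_ h1
    rw [Finset.sum_neg_distrib, ← Finset.mul_sum, neg_le_neg_iff]
    refine mul_le_mul_of_nonneg_left ?_ (pow_nonneg hl0 t)
    refine (Finset.sum_le_sum_of_subset_of_nonneg (Finset.erase_subset i₀ _)
      fun i _ _ => by positivity).trans ?_
    refine (Real.sum_mul_le_sqrt_mul_sqrt _ _ _).trans ?_
    have h2 : ∑ i, |inner ℝ (b i) v| ^ 2 = d := by
      rw [← hnormv, ← b.sum_sq_norm_inner_right v]
      rfl
    have h3 : ∑ i, |b i x| ^ 2 = 1 := by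
      have h4 := b.sum_sq_norm_inner_right (EuclideanSpace.single x (1 : ℝ))
      simp only [EuclideanSpace.inner_single_right, PiLp.norm_single, norm_one,
        one_pow, one_mul] at h4
      rw [← h4]
      rfl
    rw [h2, h3, Real.sqrt_one, mul_one]
  rw [← Finset.add_sum_erase _ _ (Finset.mem_univ i₀), hmain] at hexp
  have h6 : √(G.degree x : ℝ) * (d / ∑ y, (G.degree y : ℝ) - lambdaTwo G ^ t * √d) ≤
      √(G.degree x : ℝ) * (lazyMatrix G ^ t *ᵥ fun y => if y ∈ U then 1 else 0) x := by
    rw [hexp, mul_sub]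
    have h7 : lambdaTwo G ^ t * √d ≤ √(G.degree x : ℝ) * (lambdaTwo G ^ t * √d) :=
      le_mul_of_one_le_left (by positivity) hone
    linarith
  exact le_of_mul_le_mul_left h6 hposx

end Spectral

/-! ### Two estimates for powers -/

theorem sum_rpow_sub_one_le {ε : ℝ} (hε : 0 < ε) (hε1 : ε ≤ 1) (R : ℕ) :
    ∑ r ∈ Finset.Icc 1 R, (r : ℝ) ^ (ε - 1) ≤ (R : ℝ) ^ ε / ε := by
  induction R with
  | zero => simp [Real.zero_rpow hε.ne']
  | succ R ih =>
    rw [Finset.sum_Icc_succ_top (by omega)]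
    have hs : (0 : ℝ) < (R + 1 : ℕ) := by positivity
    have hs1 : (1 : ℝ) ≤ (R + 1 : ℕ) := by exact_mod_cast Nat.succ_pos R
    set s : ℝ := ((R + 1 : ℕ) : ℝ) with hsdef
    have hR : (R : ℝ) = s * (1 + -(1 / s)) := by
      rw [hsdef]; push_cast; field_simp; ring
    have h1s : 1 / s ≤ 1 := (div_le_one hs).2 hs1
    have h1 : (1 + -(1 / s)) ^ ε ≤ 1 + ε * -(1 / s) :=
      rpow_one_add_le_one_add_mul_self (by linarith) hε.le hε1
    have h2 : (R : ℝ) ^ ε ≤ s ^ ε - ε * s ^ (ε - 1) := by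
      rw [hR, Real.mul_rpow hs.le (by linarith), Real.rpow_sub_one hs.ne']
      refine (mul_le_mul_of_nonneg_left h1 (by positivity)).trans_eq ?_
      field_simp
      ring
    calc _ ≤ (R : ℝ) ^ ε / ε + s ^ (ε - 1) := by linarith
      _ ≤ (s ^ ε - ε * s ^ (ε - 1)) / ε + s ^ (ε - 1) := by gcongr
      _ = s ^ ε / ε := by field_simp; ring

/-- The first term suffices for r ≤ a, the second for r > a. An affine majorant is what
`optimalCost_add_le_avoidProb` can average. -/
theorem rpow_le_rpow_add_mul {ε a r : ℝ} (hε : 0 < ε) (hε1 : ε ≤ 1) (ha : 0 < a) (hr : 0 ≤ r) :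
    r ^ ε ≤ a ^ ε + a ^ (ε - 1) * r := by
  rcases le_or_gt r a with h | h
  · have h1 : r ^ ε ≤ a ^ ε := Real.rpow_le_rpow hr h hε.le
    have h2 : 0 ≤ a ^ (ε - 1) * r := by positivity
    linarith
  · have hr0 : 0 < r := ha.trans h
    have h1 : r ^ (ε - 1) ≤ a ^ (ε - 1) := Real.rpow_le_rpow_of_nonpos ha h.le (by linarith)
    have h2 : r ^ ε = r ^ (ε - 1) * r := by
      rw [Real.rpow_sub_one hr0.ne']; field_simp
    rw [h2]
    have h3 : 0 ≤ a ^ ε := by positivity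
    nlinarith

/-! ### Combining the two phases -/

section Graph

variable {V : Type*} [Fintype V] {G : SimpleGraph V} [DecidableRel G.Adj]

theorem card_mul_avgDegree [Nonempty V] :
    (Fintype.card V : ℝ) * avgDegree G = ∑ v, (G.degree v : ℝ) := by
  have : (Fintype.card V : ℝ) ≠ 0 := by exact_mod_cast Fintype.card_ne_zero
  rw [avgDegree]
  field_simp

theorem sum_degree_le_card_sq : ∑ v, (G.degree v : ℝ) ≤ (Fintype.card V : ℝ) ^ 2 := by
  have h : ∑ v : V, (G.degree v : ℝ) ≤ ∑ _v : V, (Fintype.card V : ℝ) :=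
    Finset.sum_le_sum fun v _ => by exact_mod_cast (G.degree_lt_card_verts v).le
  refine h.trans_eq ?_
  simp [sq]

/-- At least n - 1 edges force a degree sum of 2(n - 1) > n. This keeps log d_max ≥ log 2 and hence
ε < 1. -/
theorem two_le_maxDegree (hconn : G.Connected) (hn : 3 ≤ Fintype.card V) : 2 ≤ G.maxDegree := by
  by_contra hlt
  have h1 := hconn.card_vert_le_card_edgeSet_add_one
  rw [Nat.card_eq_fintype_card, Nat.card_eq_fintype_card, ← SimpleGraph.edgeFinset_card] at h1
  have h2 := G.sum_degrees_eq_twice_card_edges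
  have h3 : ∑ v, G.degree v ≤ ∑ _v : V, 1 :=
    Finset.sum_le_sum fun v _ => (G.degree_le_maxDegree v).trans (by omega)
  simp only [Finset.sum_const, Finset.card_univ, smul_eq_mul, mul_one] at h3
  omega

variable [DecidableEq V]

/-- After mixing, the simple random walk has visited `U` with probability at least half of the
stationary measure of `U`. -/
theorem half_le_hitProb (hG : ∀ v, 0 < G.degree v) (hconn : G.Connected)
    (hn : 2 ≤ Fintype.card V) {T : ℕ}
    (hT : lambdaTwo G ^ T ≤ 1 / (2 * (Fintype.card V : ℝ) ^ 2)) {U : Finset V}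
    (hU : U.Nonempty) (x : V) :
    (∑ y ∈ U, (G.degree y : ℝ)) / (2 * ∑ y, (G.degree y : ℝ)) ≤ hitProb G U T x := by
  have h1 := (lazyMatrix_pow_mulVec_ge hG hconn hn U T x).trans
    (lazyMatrix_pow_mulVec_le_hitProb hG U T x)
  refine le_trans ?_ h1
  set d := ∑ y ∈ U, (G.degree y : ℝ) with hd
  set w := ∑ y, (G.degree y : ℝ) with hw
  have hd1 : 1 ≤ d := by
    obtain ⟨u, hu⟩ := hU
    have h2 : (G.degree u : ℝ) ≤ d :=
      Finset.single_le_sum (f := fun y => (G.degree y : ℝ)) (fun y _ => Nat.cast_nonneg _) hu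
    have h3 : (1 : ℝ) ≤ G.degree u := by exact_mod_cast hG u
    linarith
  have hw0 : 0 < w := lt_of_lt_of_le (by linarith)
    (Finset.sum_le_sum_of_subset_of_nonneg (Finset.subset_univ U)
      fun y _ _ => (Nat.cast_nonneg _ : (0 : ℝ) ≤ G.degree y))
  -- Since d ≥ 1, the spectral error becomes proportional to d and takes at most half of the main
  -- term.
  have hsq : √d ≤ d := by
    rw [Real.sqrt_le_left (by linarith)]; nlinarith
  have hT' : lambdaTwo G ^ T ≤ 1 / (2 * w) := hT.trans
    (one_div_le_one_div_of_le (by positivity) (by linarith [sum_degree_le_card_sq (G := G)]))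
  have h4 : lambdaTwo G ^ T * √d ≤ 1 / (2 * w) * d :=
    mul_le_mul hT' hsq (Real.sqrt_nonneg _) (by positivity)
  have h5 : d / w = d / (2 * w) + 1 / (2 * w) * d := by field_simp; ring
  linarith

/-- From l ≤ exp(-(1 - l)) the power is at most n^(-3), and the spare factor n ≥ 2 pays for the 2.
-/
theorem lambdaTwo_pow_le {l : ℝ} (hl0 : 0 ≤ l) (hl1 : l < 1) {n T : ℕ} (hn : 2 ≤ n)
    (hT : 3 * (1 / (1 - l)) * Real.log n ≤ T) : l ^ T ≤ 1 / (2 * (n : ℝ) ^ 2) := by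
  have hn0 : (0 : ℝ) < n := by positivity
  have h1 : l ≤ Real.exp (-(1 - l)) := by
    have := Real.add_one_le_exp (-(1 - l))
    linarith
  have h2 : 3 * Real.log n ≤ (1 - l) * T := by
    have h3 : 0 < 1 - l := by linarith
    calc 3 * Real.log n = (1 - l) * (3 * (1 / (1 - l)) * Real.log n) := by field_simp
      _ ≤ _ := mul_le_mul_of_nonneg_left hT h3.le
  have hn2 : (2 : ℝ) ≤ n := by exact_mod_cast hn
  calc l ^ T ≤ Real.exp (-(1 - l)) ^ T := pow_le_pow_left₀ hl0 h1 T
    _ = Real.exp (-((1 - l) * T)) := by rw [← Real.exp_nat_mul]; ring_nf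
    _ ≤ Real.exp (-(3 * Real.log n)) := Real.exp_le_exp.2 (neg_le_neg h2)
    _ = ((n : ℝ) ^ 3)⁻¹ := by
        rw [Real.exp_neg, ← Real.log_rpow hn0, Real.exp_log (by positivity)]
        norm_cast
    _ ≤ 1 / (2 * (n : ℝ) ^ 2) := by
        rw [← one_div]
        refine one_div_le_one_div_of_le (by positivity) ?_
        nlinarith [sq_nonneg (n : ℝ)]

/-- Cost of visiting a set of vertices by boosting the probability of hitting what is left of it. -/
theorem optimalCost_le_mul_rpow (hG : ∀ v, 0 < G.degree v) {D : ℕ} (hD : 2 ≤ D)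
    (hGD : ∀ v, G.degree v ≤ D) {ε : ℝ} (hε : ε = Real.log (3 / 2) / Real.log D) (hε0 : 0 < ε)
    (hε1 : ε < 1) {T : ℕ} (hT : 0 < T) {ρ : ℝ} (hρ : 0 < ρ)
    (hhit : ∀ (U : Finset V) (x : V), U.Nonempty → U.card / ρ ≤ hitProb G U T x)
    (N : ℕ) {x : V} {U : Finset V} (hx : x ∉ U) :
    optimalCost G N x U ≤ T * ρ ^ (1 - ε) / ε * (U.card : ℝ) ^ ε := by
  have h1 := optimalCost_le_sum hG hT (q := fun r => ((r : ℝ) / ρ) ^ (1 - ε))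
    (fun r hr => Real.rpow_pos_of_pos (div_pos (by exact_mod_cast hr) hρ) _) (fun U y hU => by
      refine le_trans ?_ (hitProb_rpow_le_boostedHitProb hG hD hGD (by rw [hε]) (γ := 1 - ε)
        (by linarith) (by linarith) U T y)
      exact Real.rpow_le_rpow (by positivity) (hhit U y hU) (by linarith)) N hx
  refine h1.trans ?_
  have h2 : ∀ r ∈ Finset.Icc 1 U.card, (T : ℝ) / ((r : ℝ) / ρ) ^ (1 - ε) =
      T * ρ ^ (1 - ε) * (r : ℝ) ^ (ε - 1) := by
    intro r _
    rw [Real.div_rpow (Nat.cast_nonneg r) hρ.le, show ε - 1 = -(1 - ε) by ring,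
      Real.rpow_neg (Nat.cast_nonneg r)]
    field_simp
  rw [Finset.sum_congr rfl h2, ← Finset.mul_sum, div_mul_eq_mul_div, mul_div_assoc]
  exact mul_le_mul_of_nonneg_left (sum_rpow_sub_one_le hε0 hε1.le U.card) (by positivity)

/-- Markov's inequality for the hitting times of the simple random walk. -/
theorem avoidProb_le_half (hG : ∀ v, 0 < G.degree v) {H : ℝ}
    (hH : ∀ x y m, ∑ t ∈ Finset.range m, avoidProb G y t x ≤ H) {m : ℕ} (hm : 0 < m)
    (hmH : 2 * H ≤ m) (x y : V) : avoidProb G y m x ≤ 1 / 2 := by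
  have h1 : ∑ _t ∈ Finset.range m, avoidProb G y m x ≤ ∑ t ∈ Finset.range m, avoidProb G y t x :=
    Finset.sum_le_sum fun t ht => avoidProb_antitone hG y x (Finset.mem_range.1 ht).le
  rw [Finset.sum_const, Finset.card_range, nsmul_eq_mul] at h1
  have h2 := h1.trans (hH x y m)
  have hm' : (0 : ℝ) < m := by exact_mod_cast hm
  by_contra h
  push Not at h
  nlinarith

/-- At time t at least n - 1 - t vertices are unvisited. Over n times this totals n(n - 1)/2, while
each target contributes at most H. Costs of order n are thereby absorbed into the hitting time. -/
theorem card_sub_one_le_two_mul [Nonempty V] (hG : ∀ v, 0 < G.degree v) {H : ℝ}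
    (hH : ∀ x y m, ∑ t ∈ Finset.range m, avoidProb G y t x ≤ H) :
    (Fintype.card V : ℝ) - 1 ≤ 2 * H := by
  obtain ⟨x⟩ := ‹Nonempty V›
  set n := Fintype.card V with hn
  have hn0 : (0 : ℝ) < n := by exact_mod_cast Fintype.card_pos_iff.2 ⟨x⟩
  have h1 : ∑ t ∈ Finset.range n, ((n : ℝ) - 1 - t) ≤ n * H := by
    calc ∑ t ∈ Finset.range n, ((n : ℝ) - 1 - t)
        ≤ ∑ t ∈ Finset.range n, ∑ y, avoidProb G y t x :=
          Finset.sum_le_sum fun t _ => card_sub_le_sum_avoidProb hG t x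
      _ = ∑ y, ∑ t ∈ Finset.range n, avoidProb G y t x := Finset.sum_comm
      _ ≤ ∑ _y : V, H := Finset.sum_le_sum fun y _ => hH x y n
      _ = n * H := by simp [hn]
  have h2 : ∀ k : ℕ, ∑ t ∈ Finset.range k, ((n : ℝ) - 1 - t) = k * (n - 1) - k * (k - 1) / 2 := by
    intro k
    induction k with
    | zero => simp
    | succ k ih => rw [Finset.sum_range_succ, ih]; push_cast; ring
  rw [h2] at h1
  have h3 : (n : ℝ) * ((n - 1) / 2) ≤ n * H := by linarith
  linarith [le_of_mul_le_mul_left h3 hn0]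

/-- Run the simple random walk for `k` periods of length `m`, then boost. -/
theorem optimalCost_le_two_phase (hG : ∀ v, 0 < G.degree v) [Nonempty V] {ε Q : ℝ} (hε0 : 0 < ε)
    (hε1 : ε < 1) (hQ : 0 ≤ Q)
    (hcost : ∀ (N : ℕ) (x : V) (U : Finset V), x ∉ U → optimalCost G N x U ≤ Q * (U.card : ℝ) ^ ε)
    {m : ℕ} (hm : ∀ x y, avoidProb G y m x ≤ 1 / 2) (k N : ℕ) (x : V) :
    optimalCost G N x (Finset.univ.erase x) ≤
      k * m + 2 * Q * (Fintype.card V * (1 / 2) ^ k : ℝ) ^ ε := by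
  -- The bound on the expected number left after k periods. Splitting R^ε at this point gives two
  -- contributions of size Q·a^ε, hence the factor 2.
  set a : ℝ := Fintype.card V * (1 / 2) ^ k with ha
  have hcard : (0 : ℝ) < Fintype.card V := by exact_mod_cast Fintype.card_pos
  have ha0 : 0 < a := by positivity
  have h1 := optimalCost_add_le_avoidProb hG (N := N) (α := Q * a ^ ε) (β := Q * a ^ (ε - 1))
    (by positivity) (by positivity) (fun y U hy => by
      refine (hcost N y U hy).trans ?_
      have := mul_le_mul_of_nonneg_left
        (rpow_le_rpow_add_mul hε0 hε1.le ha0 (Nat.cast_nonneg U.card)) hQ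
      linarith) (k * m) x Finset.univ
  have h2 : optimalCost G N x (Finset.univ.erase x) ≤
      optimalCost G (N + k * m) x (Finset.univ.erase x) :=
    monotone_nat_of_le_succ (fun N => optimalCost_le_succ N x _) (Nat.le_add_right _ _)
  have h3 : ∑ v, avoidProb G v (k * m) x ≤ a := by
    refine (Finset.sum_le_sum fun v _ =>
      avoidProb_mul_le_pow hG (by norm_num) (fun x => hm x v) k x).trans_eq ?_
    simp [ha]
  have h4 : Q * a ^ (ε - 1) * ∑ v, avoidProb G v (k * m) x ≤ Q * a ^ ε := by
    refine (mul_le_mul_of_nonneg_left h3 (by positivity)).trans_eq ?_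
    rw [Real.rpow_sub_one ha0.ne']
    field_simp
  push_cast at h1
  linarith

/-- `H` is any real bound on the partial sums, which keeps infinite hitting times out of the
estimates. The lower bound on `S` is exported so that additive terms can later be absorbed into log
S. -/
theorem crwCoverTime_le_of_hitting_bound [MeasurableSpace V] [DiscreteMeasurableSpace V]
    (hconn : G.Connected) (hn : 3 ≤ Fintype.card V) {S : ℝ}
    (hS : S = avgDegree G * relaxationTime G * Real.log (Fintype.card V) / G.minDegree) :
    Real.log 3 ≤ S ∧ ∀ H : ℝ, (∀ x y m, ∑ t ∈ Finset.range m, avoidProb G y t x ≤ H) →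
      crwCoverTime G ≤ ENNReal.ofReal (H * (3 * Real.log S * Real.log G.maxDegree / (Real.log 2 * Real.log (3 / 2)) +
        3 + 48 * Real.log G.maxDegree / Real.log (3 / 2))) := by
  have hnt : Nontrivial V := Fintype.one_lt_card_iff_nontrivial.1 (by omega)
  have hG : ∀ v, 0 < G.degree v := fun v => hconn.preconnected.degree_pos_of_nontrivial v
  have hD := two_le_maxDegree hconn hn
  obtain ⟨-, -, -, -, hl0, hl1⟩ := exists_top_eigenvector hG hconn (by omega)
  set n := Fintype.card V with hndef
  set D := G.maxDegree with hDdef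
  have hn3 : (3 : ℝ) ≤ n := by exact_mod_cast hn
  have hlog3 : 1 < Real.log 3 := by
    rw [Real.lt_log_iff_exp_lt (by norm_num)]
    exact Real.exp_one_lt_d9.trans (by norm_num)
  have hlogn : Real.log 3 ≤ Real.log n := Real.log_le_log (by norm_num) hn3
  obtain ⟨v₀, hv₀⟩ := G.exists_minimal_degree_vertex
  have hδ : (1 : ℝ) ≤ G.minDegree := by rw [hv₀]; exact_mod_cast hG v₀
  set δ := (G.minDegree : ℝ) with hδdef
  have hδ0 : 0 < δ := by linarith
  have hδle : ∀ v, δ ≤ G.degree v := fun v =>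
    Nat.cast_le.2 (G.minDegree_le_degree v)
  have hvol : (n : ℝ) * avgDegree G = ∑ v, (G.degree v : ℝ) := card_mul_avgDegree
  have hn0 : (0 : ℝ) < n := by linarith
  have hδavg : δ ≤ avgDegree G := by
    have h1 : ∑ _v : V, δ ≤ ∑ v, (G.degree v : ℝ) := Finset.sum_le_sum fun v _ => hδle v
    rw [← hvol, Finset.sum_const, Finset.card_univ, nsmul_eq_mul] at h1
    exact le_of_mul_le_mul_left h1 hn0
  set d := avgDegree G with hddef
  have hd0 : 0 < d := by linarith
  have hrel : 1 ≤ relaxationTime G := by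
    rw [relaxationTime, le_div_iff₀ (by linarith)]; linarith
  set τ := relaxationTime G with hτ
  have hdδ : 1 ≤ d / δ := (one_le_div hδ0).2 hδavg
  have hτlog : Real.log 3 ≤ τ * Real.log n := by nlinarith
  have hSeq : S = d / δ * (τ * Real.log n) := by rw [hS]; ring
  have hS3 : Real.log 3 ≤ S := by rw [hSeq]; nlinarith
  refine ⟨hS3, fun H hH => ?_⟩
  have hS0 : 0 < S := by linarith
  have hlogS : 0 < Real.log S := Real.log_pos (by linarith)
  have hD2 : (2 : ℝ) ≤ D := by exact_mod_cast hD
  have hlogD : Real.log 2 ≤ Real.log D := Real.log_le_log (by norm_num) hD2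
  have hlog2 : 0 < Real.log 2 := Real.log_pos (by norm_num)
  have hlog32 : 0 < Real.log (3 / 2) := Real.log_pos (by norm_num)
  have hlog32' : Real.log (3 / 2) < Real.log 2 := Real.log_lt_log (by norm_num) (by norm_num)
  have hlogD0 : 0 < Real.log D := by linarith
  obtain ⟨ε, hε⟩ : ∃ ε, ε = Real.log (3 / 2) / Real.log D := ⟨_, rfl⟩
  have hε0 : 0 < ε := by rw [hε]; positivity
  have hε1 : ε < 1 := by rw [hε, div_lt_one hlogD0]; linarith
  -- the length of a round of the second phase
  obtain ⟨T, hTdef⟩ : ∃ T, T = ⌈3 * τ * Real.log n⌉₊ := ⟨_, rfl⟩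
  have hT1 : 3 * τ * Real.log n ≤ T := by rw [hTdef]; exact Nat.le_ceil _
  have hT2 : (T : ℝ) ≤ 4 * (τ * Real.log n) := by
    have := Nat.ceil_lt_add_one (show 0 ≤ 3 * τ * Real.log n by positivity)
    rw [← hTdef] at this
    linarith
  have hT0 : 0 < T := by
    have : (0 : ℝ) < T := by linarith
    exact_mod_cast this
  have hlT : lambdaTwo G ^ T ≤ 1 / (2 * (n : ℝ) ^ 2) :=
    lambdaTwo_pow_le hl0 hl1 (by omega) (by rw [← relaxationTime]; exact hT1)
  -- A set of r vertices has stationary measure at least rδ/(nd), and r/ρ is half of that.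
  set ρ : ℝ := 2 * d / δ * n with hρ
  have hρ0 : 0 < ρ := by positivity
  have hhit : ∀ (U : Finset V) (x : V), U.Nonempty → U.card / ρ ≤ hitProb G U T x := by
    intro U x hU
    refine le_trans ?_ (half_le_hitProb hG hconn (by omega) hlT hU x)
    rw [← hvol, hρ]
    have h1 : ∑ _y ∈ U, δ ≤ ∑ y ∈ U, (G.degree y : ℝ) := Finset.sum_le_sum fun y _ => hδle y
    rw [Finset.sum_const, nsmul_eq_mul] at h1
    calc (U.card : ℝ) / (2 * d / δ * n) = U.card * δ / (2 * (n * d)) := by field_simp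
      _ ≤ _ := div_le_div_of_nonneg_right h1 (by positivity)
  set Q : ℝ := T * ρ ^ (1 - ε) / ε with hQ
  have hQ0 : 0 ≤ Q := by positivity
  have hcost : ∀ (N : ℕ) (x : V) (U : Finset V), x ∉ U →
      optimalCost G N x U ≤ Q * (U.card : ℝ) ^ ε := fun N x U hx =>
    optimalCost_le_mul_rpow hG hD (fun v => G.degree_le_maxDegree v) hε hε0 hε1 hT0 hρ0 hhit N hx
  -- the length and number of rounds of the first phase
  have hHn := card_sub_one_le_two_mul hG hH
  rw [← hndef] at hHn
  have hH1 : 1 ≤ H := by linarith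
  obtain ⟨m, hmdef⟩ : ∃ m, m = ⌈2 * H⌉₊ := ⟨_, rfl⟩
  have hm1 : 2 * H ≤ m := by rw [hmdef]; exact Nat.le_ceil _
  have hm2 : (m : ℝ) ≤ 3 * H := by
    have := Nat.ceil_lt_add_one (show 0 ≤ 2 * H by linarith)
    rw [← hmdef] at this
    linarith
  have hm0 : 0 < m := by
    have : (0 : ℝ) < m := by linarith
    exact_mod_cast this
  obtain ⟨k, hkdef⟩ : ∃ k, k = ⌈Real.log S / (ε * Real.log 2)⌉₊ := ⟨_, rfl⟩
  have hk1 : Real.log S / (ε * Real.log 2) ≤ k := by rw [hkdef]; exact Nat.le_ceil _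
  have hk2 : (k : ℝ) ≤ Real.log S / (ε * Real.log 2) + 1 := by
    rw [hkdef]; exact (Nat.ceil_lt_add_one (by positivity)).le
  refine crwCoverTime_le_of_optimalCost_le hG (M := Q * (n : ℝ) ^ ε) (fun N x => ?_)
    (fun N x U hx => (hcost N x U hx).trans (mul_le_mul_of_nonneg_left
      (Real.rpow_le_rpow (Nat.cast_nonneg _) (by exact_mod_cast Finset.card_le_univ U) hε0.le) hQ0))
  refine (optimalCost_le_two_phase hG hε0 hε1 hQ0 hcost
    (avoidProb_le_half hG hH hm0 hm1) k N x).trans ?_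
  rw [← hndef]
  -- This is the reason for the choice of k: the factor 1/S cancels the mixing time and the degree
  -- ratio in the second phase.
  have hpow : ((1 / 2 : ℝ) ^ k) ^ ε ≤ 1 / S := by
    rw [← Real.rpow_natCast, ← Real.rpow_mul (by norm_num), Real.rpow_def_of_pos (by norm_num),
      one_div, Real.log_inv, ← Real.exp_log hS0, one_div, ← Real.exp_neg,
      Real.exp_le_exp]
    have := (div_le_iff₀ (by positivity)).1 hk1
    linarith
  have hsecond : 2 * Q * ((n : ℝ) * (1 / 2) ^ k) ^ ε ≤ 16 * n / ε := by
    rw [Real.mul_rpow hn0.le (by positivity), hQ, hρ,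
      Real.mul_rpow (x := 2 * d / δ) (by positivity) hn0.le]
    have h1 : (2 * d / δ) ^ (1 - ε) ≤ 2 * d / δ := by
      have h2 : 1 ≤ 2 * d / δ := by rw [mul_div_assoc]; linarith
      calc _ ≤ (2 * d / δ) ^ (1 : ℝ) := Real.rpow_le_rpow_of_exponent_le h2 (by linarith)
        _ = _ := Real.rpow_one _
    have h3 : (n : ℝ) ^ (1 - ε) * (n : ℝ) ^ ε = n := by
      rw [← Real.rpow_add hn0, sub_add_cancel, Real.rpow_one]
    calc 2 * (T * ((2 * d / δ) ^ (1 - ε) * (n : ℝ) ^ (1 - ε)) / ε) *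
          ((n : ℝ) ^ ε * ((1 / 2 : ℝ) ^ k) ^ ε)
        = 2 * T * (2 * d / δ) ^ (1 - ε) * ((n : ℝ) ^ (1 - ε) * (n : ℝ) ^ ε) / ε *
          ((1 / 2 : ℝ) ^ k) ^ ε := by ring
      _ = 2 * T * (2 * d / δ) ^ (1 - ε) * n / ε * ((1 / 2 : ℝ) ^ k) ^ ε := by rw [h3]
      _ ≤ 2 * (4 * (τ * Real.log n)) * (2 * d / δ) * n / ε * (1 / S) := by gcongr
      _ = 16 * n / ε * (d / δ * (τ * Real.log n) * (1 / S)) := by ring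
      _ = 16 * n / ε := by rw [← hSeq, mul_one_div_cancel hS0.ne', mul_one]
  have hnH : (n : ℝ) ≤ 3 * H := by linarith
  have hkm : (k : ℝ) * m ≤ (Real.log S / (ε * Real.log 2) + 1) * (3 * H) :=
    mul_le_mul hk2 hm2 (Nat.cast_nonneg _) (by positivity)
  have h16 : 16 * (n : ℝ) / ε ≤ 48 * H / ε := div_le_div_of_nonneg_right (by linarith) hε0.le
  refine (add_le_add hkm (hsecond.trans h16)).trans_eq ?_
  rw [hε]
  field_simp

end Graph

end ChoiceWalk

theorem theorem5p1 :
    ∃ C : ℝ, 0 < C ∧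
      ∀ (V : Type*) [Fintype V] [DecidableEq V] [MeasurableSpace V] [DiscreteMeasurableSpace V]
        (G : SimpleGraph V) [DecidableRel G.Adj],
        G.Connected → 3 ≤ Fintype.card V →
          ChoiceWalk.crwCoverTime G ≤
            ENNReal.ofReal (C * Real.log G.maxDegree *
              Real.log (ChoiceWalk.avgDegree G * ChoiceWalk.relaxationTime G *
                Real.log (Fintype.card V) / G.minDegree)) *
            ChoiceWalk.srwHittingTime G := by
  have hlog3 : 1 < Real.log 3 := by
    rw [Real.lt_log_iff_exp_lt (by norm_num)]
    exact Real.exp_one_lt_d9.trans (by norm_num)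
  have hll : 0 < Real.log (Real.log 3) := Real.log_pos hlog3
  have hlog2 : 0 < Real.log 2 := Real.log_pos (by norm_num)
  have hlog32 : 0 < Real.log (3 / 2) := Real.log_pos (by norm_num)
  -- One term for each summand in `crwCoverTime_le_of_hitting_bound`; the last two are absorbed
  -- using log d_max ≥ log 2 and log S ≥ log log 3 > 0.
  refine ⟨3 / (Real.log 2 * Real.log (3 / 2)) + 3 / (Real.log 2 * Real.log (Real.log 3)) +
    48 / (Real.log (Real.log 3) * Real.log (3 / 2)), by positivity, ?_⟩
  intro V _ _ _ _ G _ hconn hn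
  obtain ⟨S, hS⟩ : ∃ S, S = ChoiceWalk.avgDegree G * ChoiceWalk.relaxationTime G *
    Real.log (Fintype.card V) / G.minDegree := ⟨_, rfl⟩
  rw [← hS]
  have hnt : Nontrivial V := Fintype.one_lt_card_iff_nontrivial.1 (by omega)
  have hG : ∀ v, 0 < G.degree v := fun v => hconn.preconnected.degree_pos_of_nontrivial v
  have hlogD : Real.log 2 ≤ Real.log G.maxDegree :=
    Real.log_le_log (by norm_num) (by exact_mod_cast ChoiceWalk.two_le_maxDegree hconn hn)
  have hlogD0 : 0 < Real.log G.maxDegree := by linarith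
  have hsum := ChoiceWalk.sum_avoidProb_le_srwHittingTime hG
  obtain ⟨hS3, hle⟩ := ChoiceWalk.crwCoverTime_le_of_hitting_bound hconn hn hS
  have hlogS : Real.log (Real.log 3) ≤ Real.log S := Real.log_le_log (by linarith) hS3
  have hlogS0 : 0 < Real.log S := by linarith
  -- An infinite hitting time would make the bound trivial, so its finiteness need not be proved.
  by_cases htop : ChoiceWalk.srwHittingTime G = ∞
  · rw [htop, ENNReal.mul_top (ENNReal.ofReal_pos.2 (by positivity)).ne']
    exact le_top
  · have hH : ∀ x y m, ∑ t ∈ Finset.range m, ChoiceWalk.avoidProb G y t x ≤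
        (ChoiceWalk.srwHittingTime G).toReal := fun x y m =>
      (ENNReal.ofReal_le_iff_le_toReal htop).1 (hsum x y m)
    rw [← ENNReal.ofReal_toReal htop, ← ENNReal.ofReal_mul (by positivity)]
    refine (hle _ hH).trans (ENNReal.ofReal_le_ofReal ?_)
    rw [mul_comm]
    refine mul_le_mul_of_nonneg_right ?_ ENNReal.toReal_nonneg
    rw [add_mul, add_mul, add_mul, add_mul]
    refine add_le_add (add_le_add (le_of_eq (by ring)) ?_) ?_
    · rw [div_mul_eq_mul_div, div_mul_eq_mul_div, le_div_iff₀ (by positivity), mul_assoc 3]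
      exact mul_le_mul_of_nonneg_left (mul_le_mul hlogD hlogS hll.le hlogD0.le) (by norm_num)
    · rw [div_mul_eq_mul_div, div_mul_eq_mul_div, div_le_div_iff₀ hlog32 (by positivity)]
      have := mul_le_mul_of_nonneg_left hlogS
        (show 0 ≤ 48 * Real.log G.maxDegree * Real.log (3 / 2) by positivity)
      linarith
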